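/- Let $Q$ be a finite-dimensional smooth manifold without boundary, $g$ a smooth Riemannian metric on $Q$ and $D\subseteq TQ$ a smooth distribution of constant rank $k$ (in particular this covers every nonholonomic mechanical system $(Q,g,V,D)$, with $V$ a smooth potential and $D$ non-integrable). Let $\pi_Q:T^*Q\to Q$ be the cotangent bundle with its canonical symplectic form $\omega_Q=dq^i\wedge dp_i$; for $F\in C^\infty(T^*Q)$ let $X_F$ be the Hamiltonian vector field, $i_{X_F}\omega_Q=dF$, and put $\{F,G\}_{can}=\omega_Q(X_F,X_G)$. Let $\flat_g:TQ\to T^*Q$, $\flat_g(v)=g(v,\cdot)$, let $M=\flat_g(D)\subseteq T^*Q$ be the constraint submanifold, $i_M:M\to T^*Q$ the inclusion, $D^\circ\subseteq T^*Q$ the annihilator of $D$, and let $\gamma:T^*Q\to M$ be the (orthogonal) projection given by $T^*Q=M\oplus D^\circ$. For $x\in M$ let $$(T^DM)_x=\{Z\in T_xM \mid T\pi_Q(Z)\in D\}.$$ Then: 1. For every $x\in M$ there is a symplectic decomposition $T_x(T^*Q)=(T^DM)_x\oplus\big((T^DM)_x\big)^{\perp_{\omega_Q}}$. Let $\mathcal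 P$ denote the projection onto the first summand. 2. Every $f\in C^\infty(M)$ has a smooth extension $\tilde f$ to $T^*Q$, and the formula $$\{f,g\}_{nh}=\omega_Q(\mathcal P X_{\tilde f},\mathcal P X_{\tilde g})\circ i_M ,\qquad f,g\in C^\infty(M),$$ does not depend on the smooth extensions $\tilde f,\tilde g$ of $f,g$ and defines an almost Poisson bracket on $M$, that is, an $\mathbb R$-bilinear, skew-symmetric map $C^\infty(M)\times C^\infty(M)\to C^\infty(M)$ satisfying the Leibniz rule (the nonholonomic bracket). Likewise $\{f,g\}_E=\{f\circ\gamma,g\circ\gamma\}_{can}\circ i_M$ defines an almost Poisson bracket on $M$ (the Eden bracket). 3. The identity map $\mathrm{id}:(M,\{\,,\,\}_{nh})\to(M,\{\,,\,\}_E)$ is an almost Poisson isomorphism, i.e. a diffeomorphism that preserves the brackets; in other words $\{f,g\}_{nh}=\{f,g\}_E$ for all $f,g\in C^\infty(M)$. -/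

import Mathlib

open Bundle
open scoped Manifold ContDiff Topology

noncomputable section

/-! ### Smooth maps, functions and tangent spaces on (embedded) submanifolds

A submanifold of a manifold `X` is handled as a subset `S : Set X`. -/

section Subsets

variable {E₁ : Type*} [NormedAddCommGroup E₁] [NormedSpace ℝ E₁]
  {H₁ : Type*} [TopologicalSpace H₁]
  {X : Type*} [TopologicalSpace X] [ChartedSpace H₁ X]
  {E₂ : Type*} [NormedAddCommGroup E₂] [NormedSpace ℝ E₂]
  {H₂ : Type*} [TopologicalSpace H₂]
  {Y : Type*} [TopologicalSpace Y] [ChartedSpace H₂ Y]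

/-- A map `h : S → Y` defined on a subset `S` of a manifold `X` is smooth if around every point of
`S` it is the restriction of a smooth map defined on an open subset of `X`. -/
def IsSmoothOnSubset (I : ModelWithCorners ℝ E₁ H₁) (J : ModelWithCorners ℝ E₂ H₂)
    (S : Set X) (h : S → Y) : Prop :=
  ∀ x : S, ∃ U : Set X, IsOpen U ∧ (x : X) ∈ U ∧
    ∃ F : X → Y, ContMDiffOn I J ∞ F U ∧ ∀ y : S, (y : X) ∈ U → F y = h y

/-- The algebra `C^∞(S)` of smooth real functions on `S`. -/
def smoothFunctions (I : ModelWithCorners ℝ E₁ H₁) (S : Set X) : Subalgebra ℝ (S → ℝ) where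
  carrier := {f | IsSmoothOnSubset I 𝓘(ℝ, ℝ) S f}
  mul_mem' := by
    intro a b ha hb x
    obtain ⟨U, hU, hxU, F, hF, hFa⟩ := ha x
    obtain ⟨V, hV, hxV, G, hG, hGb⟩ := hb x
    exact ⟨U ∩ V, hU.inter hV, ⟨hxU, hxV⟩, fun y => F y * G y,
      (hF.mono Set.inter_subset_left).mul (hG.mono Set.inter_subset_right),
      fun y hy => by simp [hFa y hy.1, hGb y hy.2]⟩
  add_mem' := by
    intro a b ha hb x
    obtain ⟨U, hU, hxU, F, hF, hFa⟩ := ha x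
    obtain ⟨V, hV, hxV, G, hG, hGb⟩ := hb x
    exact ⟨U ∩ V, hU.inter hV, ⟨hxU, hxV⟩, fun y => F y + G y,
      (hF.mono Set.inter_subset_left).add (hG.mono Set.inter_subset_right),
      fun y hy => by simp [hFa y hy.1, hGb y hy.2]⟩
  algebraMap_mem' := fun r x =>
    ⟨Set.univ, isOpen_univ, Set.mem_univ _, fun _ => r, contMDiffOn_const, fun _ _ => rfl⟩

/-- The pullback `f ∘ φ` of a smooth function along a smooth map `φ : S → T`. -/
def smoothPullback {I : ModelWithCorners ℝ E₁ H₁} {J : ModelWithCorners ℝ E₂ H₂}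
    {S : Set X} {T : Set Y} (φ : S → T) (hφ : IsSmoothOnSubset I J S (fun x => (φ x : Y)))
    (f : smoothFunctions J T) : smoothFunctions I S :=
  ⟨fun x => f.1 (φ x), by
    intro x
    obtain ⟨U, hU, hxU, F, hF, hFφ⟩ := hφ x
    obtain ⟨V, hV, hxV, G, hG, hGf⟩ := f.2 (φ x)
    refine ⟨U ∩ F ⁻¹' V, hF.continuousOn.isOpen_inter_preimage hU hV,
      ⟨hxU, by simpa [hFφ x hxU] using hxV⟩, fun y => G (F y),
      hG.comp (hF.mono Set.inter_subset_left) (fun y hy => hy.2), ?_⟩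
    intro y hy
    have h1 := hFφ y hy.1
    have h2 : (φ y : Y) ∈ V := by simpa [h1] using hy.2
    simp only [h1, hGf _ h2]⟩

/-- `F` is a smooth extension to `X` of the function `f` on `S`. -/
def IsSmoothExtension (I : ModelWithCorners ℝ E₁ H₁) {S : Set X} (f : S → ℝ) (F : X → ℝ) : Prop :=
  ContMDiff I 𝓘(ℝ, ℝ) ∞ F ∧ ∀ x : S, F x = f x

/-- The tangent space `T_x S ⊆ T_x X` of a submanifold `S` of `X` at `x ∈ S`: the tangent vectors
of `X` at `x` that annihilate every smooth function which is defined near `x` and vanishes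
on `S`. -/
def tangentSpaceOfSubset (I : ModelWithCorners ℝ E₁ H₁) (S : Set X) (x : X) :
    Submodule ℝ (TangentSpace I x) where
  carrier := {v | ∀ (U : Set X) (F : X → ℝ), IsOpen U → x ∈ U → ContMDiffOn I 𝓘(ℝ, ℝ) ∞ F U →
    (∀ y ∈ U ∩ S, F y = 0) → mfderiv I 𝓘(ℝ, ℝ) F x v = 0}
  add_mem' := by
    intro a b ha hb U F hU hx hF h0
    rw [map_add, ha U F hU hx hF h0, hb U F hU hx hF h0, add_zero]
  zero_mem' := by
    intro U F hU hx hF h0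
    exact map_zero _
  smul_mem' := by
    intro c a ha U F hU hx hF h0
    rw [map_smul, ha U F hU hx hF h0, smul_zero]

/-- An almost Poisson bracket on `S`: an `ℝ`-bilinear skew-symmetric operation
`C^∞(S) × C^∞(S) → C^∞(S)` satisfying the Leibniz rule. -/
structure AlmostPoissonBracket (I : ModelWithCorners ℝ E₁ H₁) (S : Set X) where
  /-- The underlying bilinear operation. -/
  bracket : smoothFunctions I S →ₗ[ℝ] smoothFunctions I S →ₗ[ℝ] smoothFunctions I S
  /-- Skew-symmetry. -/
  skew : ∀ f g, bracket g f = -bracket f g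
  /-- The Leibniz rule. -/
  leibniz : ∀ f f' g, bracket (f * f') g = f * bracket f' g + f' * bracket f g

/-- A bijection `φ : S ≃ T` is an almost Poisson isomorphism `(S, B) → (T, B')` if it is a
diffeomorphism and `{f ∘ φ, g ∘ φ}_B = {f, g}_{B'} ∘ φ` for all `f, g ∈ C^∞(T)`. -/
structure IsAlmostPoissonIso {I : ModelWithCorners ℝ E₁ H₁} {J : ModelWithCorners ℝ E₂ H₂}
    {S : Set X} {T : Set Y} (B : AlmostPoissonBracket I S) (B' : AlmostPoissonBracket J T)
    (φ : S ≃ T) : Prop where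
  smooth : IsSmoothOnSubset I J S (fun x => (φ x : Y))
  smooth_symm : IsSmoothOnSubset J I T (fun y => (φ.symm y : X))
  map_bracket : ∀ f g : smoothFunctions J T,
    B.bracket (smoothPullback (⇑φ) smooth f) (smoothPullback (⇑φ) smooth g) =
      smoothPullback (⇑φ) smooth (B'.bracket f g)

end Subsets

/-! ### Symplectic linear algebra -/

/-- The projection onto `W` along its `B`-orthogonal complement `W^⊥`, when `V = W ⊕ W^⊥`. -/
def orthogonalProjectionAlong {V : Type*} [AddCommGroup V] [Module ℝ V]
    (B : LinearMap.BilinForm ℝ V) (W : Submodule ℝ V) : V →ₗ[ℝ] V :=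
  open Classical in
  if h : IsCompl W (B.orthogonal W) then W.subtype ∘ₗ W.projectionOnto (B.orthogonal W) h
  else 0

/-! ### The cotangent bundle and its canonical symplectic form -/

section Cotangent

variable (E : Type*) [NormedAddCommGroup E] [NormedSpace ℝ E] [FiniteDimensional ℝ E]
  (Q : Type*) [TopologicalSpace Q] [ChartedSpace E Q] [IsManifold 𝓘(ℝ, E) ∞ Q]

/-- The cotangent space `T*_q Q`. -/
abbrev CotangentSpace {Q : Type*} [TopologicalSpace Q] [ChartedSpace E Q] (q : Q) : Type _ :=
  TangentSpace 𝓘(ℝ, E) q →L[ℝ] ℝ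

/-- The cotangent bundle `T*Q`, with Mathlib's topology and smooth structure on the bundle of
linear forms on the tangent spaces. -/
abbrev CotangentBundle : Type _ :=
  TotalSpace (E →L[ℝ] ℝ) (fun q : Q => TangentSpace 𝓘(ℝ, E) q →L[ℝ] Bundle.Trivial Q ℝ q)

/-- The model with corners of `T*Q` as a manifold modelled on `E × E*`. -/
abbrev cotangentModel : ModelWithCorners ℝ (E × (E →L[ℝ] ℝ)) (ModelProd E (E →L[ℝ] ℝ)) :=
  𝓘(ℝ, E).prod 𝓘(ℝ, E →L[ℝ] ℝ)

variable {E Q}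

/-- The position coordinates `(q^i)` on `T*Q` induced by the preferred chart of `Q` at the base
point of `x₀`. -/
def qCoord (x₀ y : CotangentBundle E Q) : E :=
  extChartAt 𝓘(ℝ, E) x₀.proj y.proj

/-- The momentum coordinates `(p_i)` on `T*Q` induced by the preferred chart `φ` of `Q` at the base
point of `x₀`: the components `α ∘ (d_q φ)⁻¹` of a covector `α ∈ T*_q Q`. -/
def pCoord (x₀ y : CotangentBundle E Q) : E →L[ℝ] ℝ :=
  y.2 ∘L (mfderiv 𝓘(ℝ, E) 𝓘(ℝ, E) (extChartAt 𝓘(ℝ, E) x₀.proj) y.proj).inverse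

/-- The form `dq^i ∧ dp_i : (u, v) ↦ dq^i(u) dp_i(v) - dq^i(v) dp_i(u)`, for an `E`-valued `dq` and
an `E*`-valued `dp`. -/
def dqWedgeDp {V : Type*} [AddCommGroup V] [Module ℝ V] (dq : V →ₗ[ℝ] E)
    (dp : V →ₗ[ℝ] (E →L[ℝ] ℝ)) : LinearMap.BilinForm ℝ V :=
  LinearMap.mk₂ ℝ (fun u v => dp v (dq u) - dp u (dq v))
    (by intros; simp; ring) (by intros; simp; ring) (by intros; simp; ring) (by intros; simp; ring)

/-- The differential at `x` of the position coordinates induced by the chart at `x`. -/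
def dqAt (x : CotangentBundle E Q) : TangentSpace (cotangentModel E) x →L[ℝ] E :=
  mfderiv (cotangentModel E) 𝓘(ℝ, E) (qCoord x) x

/-- The differential at `x` of the momentum coordinates induced by the chart at `x`. -/
def dpAt (x : CotangentBundle E Q) : TangentSpace (cotangentModel E) x →L[ℝ] (E →L[ℝ] ℝ) :=
  mfderiv (cotangentModel E) 𝓘(ℝ, E →L[ℝ] ℝ) (pCoord x) x

/-- The canonical symplectic form `ω_Q = dq^i ∧ dp_i` of `T*Q` at the point `x`, written in the
canonical coordinates around `x` induced by the chart of `Q` at the base point of `x`. -/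
def canonicalSymplecticForm (x : CotangentBundle E Q) :
    LinearMap.BilinForm ℝ (TangentSpace (cotangentModel E) x) :=
  dqWedgeDp (dqAt x).toLinearMap (dpAt x).toLinearMap

/-- The canonical coordinates are the preferred chart of the manifold `T*Q`. -/
theorem extChartAt_cotangentBundle (x₀ y : CotangentBundle E Q)
    (hy : y.proj ∈ (chartAt E x₀.proj).source) :
    extChartAt (cotangentModel E) x₀ y = (qCoord x₀ y, pCoord x₀ y) := by
  rw [FiberBundle.extChartAt]
  have hy' : y.proj ∈ (trivializationAt E (TangentSpace 𝓘(ℝ, E) : Q → Type _) x₀.proj).baseSet := hy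
  have : (trivializationAt E (TangentSpace 𝓘(ℝ, E) : Q → Type _) x₀.proj).symmL ℝ y.proj =
      (mfderiv 𝓘(ℝ, E) 𝓘(ℝ, E) (extChartAt 𝓘(ℝ, E) x₀.proj) y.proj).inverse := by
    rw [← TangentBundle.continuousLinearMapAt_trivializationAt hy]
    symm
    apply ContinuousLinearMap.inverse_eq
    · ext v
      exact Trivialization.continuousLinearMapAt_symmL _ hy' v
    · ext v
      exact Trivialization.symmL_continuousLinearMapAt _ hy' v
  simp [hom_trivializationAt_apply, ContinuousLinearMap.inCoordinates, qCoord, pCoord, this]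

/-- In the identification `T_x(T*Q) = E × E*` given by the chart at `x`, `dq` and `dp` are the
projections onto the factors. -/
theorem mfderiv_coords (x : CotangentBundle E Q) :
    dqAt x = ContinuousLinearMap.fst ℝ E (E →L[ℝ] ℝ) ∧
      dpAt x = ContinuousLinearMap.snd ℝ E (E →L[ℝ] ℝ) := by
  have h1 : ∀ᶠ y in 𝓝 x, extChartAt (cotangentModel E) x y = (qCoord x y, pCoord x y) := by
    have hc : ContinuousAt (fun y : CotangentBundle E Q => y.proj) x :=
      (FiberBundle.continuous_proj (E →L[ℝ] ℝ) _).continuousAt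
    filter_upwards [hc ((chartAt E x.proj).open_source.mem_nhds (mem_chart_source E x.proj))]
      with y hy using extChartAt_cotangentBundle x y hy
  have h2 : HasMFDerivAt (cotangentModel E) 𝓘(ℝ, E × (E →L[ℝ] ℝ))
      (extChartAt (cotangentModel E) x) x (ContinuousLinearMap.id ℝ (E × (E →L[ℝ] ℝ))) := by
    have := (mdifferentiableAt_extChartAt (I := cotangentModel E)
      (mem_chart_source _ x)).hasMFDerivAt
    rwa [mfderiv_extChartAt_self] at this
  constructor
  · have h3 := ((ContinuousLinearMap.fst ℝ E (E →L[ℝ] ℝ)).hasMFDerivAt (x := extChartAt (cotangentModel E) x x)).comp x h2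
    exact (h3.congr_of_eventuallyEq (h1.mono fun y hy => by
      rw [Function.comp_apply, hy]; rfl)).mfderiv
  · have h3 := ((ContinuousLinearMap.snd ℝ E (E →L[ℝ] ℝ)).hasMFDerivAt (x := extChartAt (cotangentModel E) x x)).comp x h2
    exact (h3.congr_of_eventuallyEq (h1.mono fun y hy => by
      rw [Function.comp_apply, hy]; rfl)).mfderiv

theorem canonicalSymplecticForm_apply (x : CotangentBundle E Q) (u v : E × (E →L[ℝ] ℝ)) :
    canonicalSymplecticForm x u v = v.2 u.1 - u.2 v.1 := by
  change dpAt x v (dqAt x u) - dpAt x u (dqAt x v) = _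
  rw [(mfderiv_coords x).1, (mfderiv_coords x).2]
  rfl

theorem canonicalSymplecticForm_nondegenerate (x : CotangentBundle E Q) :
    (canonicalSymplecticForm x).Nondegenerate := by
  have key : ∀ u : E × (E →L[ℝ] ℝ),
      (∀ v : E × (E →L[ℝ] ℝ), canonicalSymplecticForm x u v = 0) → u = 0 := by
    intro u hu
    simp only [canonicalSymplecticForm_apply] at hu
    refine Prod.ext ?_ ?_
    · exact SeparatingDual.eq_zero_of_forall_dual_eq_zero (R := ℝ) fun p => by simpa using hu (0, p)
    · ext w
      simpa using hu (w, 0)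
  refine ⟨fun u hu => key u hu, fun u hu => key u fun v => ?_⟩
  have h1 := canonicalSymplecticForm_apply x v u
  have h2 := canonicalSymplecticForm_apply x u v
  have h3 : canonicalSymplecticForm x v u = 0 := hu v
  have h4 : u.2 v.1 - v.2 u.1 = 0 := h1.symm.trans h3
  exact h2.trans (by linarith)

instance instFiniteDimensionalTangentSpaceCotangentBundle (x : CotangentBundle E Q) :
    FiniteDimensional ℝ (TangentSpace (cotangentModel E) x) :=
  inferInstanceAs (FiniteDimensional ℝ (E × (E →L[ℝ] ℝ)))

/-- The differential of a real function on `T*Q`. -/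
def functionDifferential (F : CotangentBundle E Q → ℝ) (x : CotangentBundle E Q) :
    TangentSpace (cotangentModel E) x →L[ℝ] ℝ :=
  mfderiv (cotangentModel E) 𝓘(ℝ, ℝ) F x

/-- The Hamiltonian vector field `X_F` of `F`: the solution of `i_{X_F} ω_Q = dF`. -/
def hamiltonianVectorField (F : CotangentBundle E Q → ℝ) (x : CotangentBundle E Q) :
    TangentSpace (cotangentModel E) x :=
  ((canonicalSymplecticForm x).toDual (canonicalSymplecticForm_nondegenerate x)).symm
    (functionDifferential F x).toLinearMap

/-- The canonical Poisson bracket `{F, G}_can = ω_Q(X_F, X_G)`. -/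
def canonicalBracket (F G : CotangentBundle E Q → ℝ) (x : CotangentBundle E Q) : ℝ :=
  canonicalSymplecticForm x (hamiltonianVectorField F x) (hamiltonianVectorField G x)

end Cotangent

/-! ### Nonholonomic constraints -/

section Nonholonomic

variable {E : Type*} [NormedAddCommGroup E] [NormedSpace ℝ E] [FiniteDimensional ℝ E]
  {Q : Type*} [TopologicalSpace Q] [ChartedSpace E Q] [IsManifold 𝓘(ℝ, E) ∞ Q]

variable (E Q) in
/-- A smooth Riemannian metric on `Q`. -/
abbrev SmoothMetric : Type _ :=
  ContMDiffRiemannianMetric 𝓘(ℝ, E) ∞ E (TangentSpace 𝓘(ℝ, E) : Q → Type _)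

variable (E Q) in
/-- A smooth distribution of rank `k` on `Q`: a subspace `D_q ⊆ T_q Q` of dimension `k` for every
`q`, locally spanned by `k` smooth vector fields. -/
structure SmoothDistribution (k : ℕ) where
  /-- The subspace `D_q`. -/
  fiber : ∀ q : Q, Submodule ℝ (TangentSpace 𝓘(ℝ, E) q)
  finrank_fiber : ∀ q, Module.finrank ℝ (fiber q) = k
  exists_local_frame : ∀ q₀ : Q, ∃ U : Set Q, IsOpen U ∧ q₀ ∈ U ∧
    ∃ X : Fin k → ∀ q : Q, TangentSpace 𝓘(ℝ, E) q,
      (∀ i, ContMDiffOn 𝓘(ℝ, E) (𝓘(ℝ, E).prod 𝓘(ℝ, E)) ∞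
        (fun q => (TotalSpace.mk' E q (X i q) : TangentBundle 𝓘(ℝ, E) Q)) U) ∧
      ∀ q ∈ U, fiber q = Submodule.span ℝ (Set.range fun i => X i q)

variable {k : ℕ} (g : SmoothMetric E Q) (D : SmoothDistribution E Q k)

/-- The isomorphism `♭_g : T_q Q → T*_q Q`, `v ↦ g(v, ·)` (the Legendre transformation). -/
def flat (q : Q) : TangentSpace 𝓘(ℝ, E) q →ₗ[ℝ] CotangentSpace E q :=
  (g.inner q).toLinearMap

/-- The fibre `M_q = ♭_g(D_q)` of the constraint submanifold. -/
def constraintFiber (q : Q) : Submodule ℝ (CotangentSpace E q) :=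
  (D.fiber q).map (flat g q)

/-- The constraint submanifold `M = ♭_g(D) ⊆ T*Q`. -/
def constraintSubmanifold : Set (CotangentBundle E Q) :=
  {x | x.2 ∈ constraintFiber g D x.proj}

/-- The annihilator `D_q° ⊆ T*_q Q`. -/
def annihilatorFiber (q : Q) : Submodule ℝ (CotangentSpace E q) where
  carrier := {α | ∀ v ∈ D.fiber q, α v = 0}
  add_mem' := fun {a b} ha hb v hv => by simp [ha v hv, hb v hv]
  zero_mem' := fun v _ => rfl
  smul_mem' := fun c a ha v hv => by simp [ha v hv]

/-- The decomposition `T*_q Q = M_q ⊕ D_q°`. -/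
theorem isCompl_constraintFiber (q : Q) :
    IsCompl (constraintFiber g D q) (annihilatorFiber D q) := by
  have : FiniteDimensional ℝ (TangentSpace 𝓘(ℝ, E) q) :=
    inferInstanceAs (FiniteDimensional ℝ E)
  -- the metric restricts to a nondegenerate form on `D_q`
  let r : D.fiber q →ₗ[ℝ] Module.Dual ℝ (D.fiber q) :=
    { toFun := fun v => (flat g q v).toLinearMap ∘ₗ (D.fiber q).subtype
      map_add' := fun v w => by ext; simp
      map_smul' := fun c v => by ext; simp }
  have hr : Function.Injective r := by
    rw [← LinearMap.ker_eq_bot, LinearMap.ker_eq_bot']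
    intro v hv
    by_contra hne
    have h1 : g.inner q v v = 0 := LinearMap.congr_fun hv v
    exact (g.pos q v fun h => hne (Subtype.ext h)).ne' h1
  have hr' : Function.Surjective r :=
    (LinearMap.injective_iff_surjective_of_finrank_eq_finrank Subspace.dual_finrank_eq.symm).1 hr
  refine IsCompl.of_le ?_ ?_
  · rintro α ⟨⟨v, hv, rfl⟩, hα⟩
    have h1 : r ⟨v, hv⟩ = 0 := by
      ext w
      exact hα w.1 w.2
    have h2 : (⟨v, hv⟩ : D.fiber q) = 0 := hr (h1.trans (map_zero r).symm)
    have h3 : v = 0 := congrArg Subtype.val h2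
    simp [h3]
  · intro α _
    obtain ⟨v, hv⟩ := hr' (α.toLinearMap ∘ₗ (D.fiber q).subtype)
    refine Submodule.mem_sup.2 ⟨flat g q v, ⟨v, v.2, rfl⟩, α - flat g q v, ?_, by abel⟩
    intro w hw
    have h1 : flat g q v w = α w := LinearMap.congr_fun hv ⟨w, hw⟩
    exact (sub_apply _ _ _).trans (by rw [h1, sub_self])

/-- The orthogonal projection `γ_q : T*_q Q → M_q`, i.e. the projection of the decomposition
`T*_q Q = M_q ⊕ D_q°`. -/
def edenProjectionFiber (q : Q) : CotangentSpace E q →ₗ[ℝ] constraintFiber g D q :=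
  (constraintFiber g D q).projectionOnto (annihilatorFiber D q) (isCompl_constraintFiber g D q)

/-- The projection `γ : T*Q → M`. -/
def edenProjection (x : CotangentBundle E Q) : constraintSubmanifold g D :=
  ⟨⟨x.proj, (edenProjectionFiber g D x.proj x.2 : CotangentSpace E x.proj)⟩,
    (edenProjectionFiber g D x.proj x.2).2⟩

/-- The differential at `x` of the bundle projection `π_Q : T*Q → Q`. -/
def projDifferential (x : CotangentBundle E Q) :
    TangentSpace (cotangentModel E) x →ₗ[ℝ] TangentSpace 𝓘(ℝ, E) x.proj :=
  (mfderiv (cotangentModel E) 𝓘(ℝ, E) (fun y : CotangentBundle E Q => y.proj) x).toLinearMap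

/-- The space `(T^D M)_x = {Z ∈ T_x M | Tπ_Q(Z) ∈ D}`. -/
def constrainedTangentSpace (x : CotangentBundle E Q) :
    Submodule ℝ (TangentSpace (cotangentModel E) x) :=
  tangentSpaceOfSubset (cotangentModel E) (constraintSubmanifold g D) x ⊓
    (D.fiber x.proj).comap (projDifferential x)

/-- The projection `𝒫 : T_x(T*Q) → (T^D M)_x ⊆ T_x(T*Q)` at `x ∈ M` of the decomposition
`T_x(T*Q) = (T^D M)_x ⊕ ((T^D M)_x)^⊥`. -/
def symplecticProjection (x : CotangentBundle E Q) :
    TangentSpace (cotangentModel E) x →ₗ[ℝ] TangentSpace (cotangentModel E) x :=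
  orthogonalProjectionAlong (canonicalSymplecticForm x) (constrainedTangentSpace g D x)

/-- An almost Poisson bracket `B` on `M` is the nonholonomic bracket if, for all `f, g ∈ C^∞(M)`,
smooth extensions to `T*Q` exist and `{f, g} = ω_Q(𝒫 X_F, 𝒫 X_G) ∘ i_M` for every choice of smooth
extensions `F` and `G` of `f` and `g`. -/
def IsNonholonomicBracket
    (B : AlmostPoissonBracket (cotangentModel E) (constraintSubmanifold g D)) : Prop :=
  (∀ f : smoothFunctions (cotangentModel E) (constraintSubmanifold g D),
    ∃ F, IsSmoothExtension (cotangentModel E) f.1 F) ∧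
  ∀ (f₁ f₂ : smoothFunctions (cotangentModel E) (constraintSubmanifold g D))
    (F₁ F₂ : CotangentBundle E Q → ℝ),
    IsSmoothExtension (cotangentModel E) f₁.1 F₁ → IsSmoothExtension (cotangentModel E) f₂.1 F₂ →
    ∀ x : constraintSubmanifold g D,
      (B.bracket f₁ f₂).1 x = canonicalSymplecticForm x.1
        (symplecticProjection g D x.1 (hamiltonianVectorField F₁ x.1))
        (symplecticProjection g D x.1 (hamiltonianVectorField F₂ x.1))

/-- An almost Poisson bracket `B` on `M` is the Eden bracket if
`{f, g} = {f ∘ γ, g ∘ γ}_can ∘ i_M` for all `f, g ∈ C^∞(M)`. -/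
def IsEdenBracket
    (B : AlmostPoissonBracket (cotangentModel E) (constraintSubmanifold g D)) : Prop :=
  ∀ (f₁ f₂ : smoothFunctions (cotangentModel E) (constraintSubmanifold g D))
    (x : constraintSubmanifold g D),
    (B.bracket f₁ f₂).1 x = canonicalBracket (fun y => f₁.1 (edenProjection g D y))
      (fun y => f₂.1 (edenProjection g D y)) x.1

end Nonholonomic

end

/-! The fibrewise projection `γ` is a smooth idempotent bundle map of `T*Q` with image `M`. In a
local frame of `D` it is given by inverting a Gram matrix, which proves its smoothness. Hence `f ∘
γ` is a smooth extension of `f`, and `T_x M` is the fixed space of `Tγ` at `x ∈ M`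
(`mem_tangentSpaceOfSubset_iff`).

Write `W = (T^D M)_x`. If `v ∈ W ∩ W^⊥`, pairing `v` with the vertical lift of `♭_g(Tπ v)`, which
lies in `W`, gives `g(Tπ v, Tπ v) = 0`. So `v` is the vertical lift of some `♭_g(d)` with `d ∈ D`,
and pairing with `Tγ(d, 0) ∈ W` gives `g(d, d) = 0`. Thus `W` is symplectic.

On `W ⊆ T_x M` the form `ω(X_F, ·) = dF` depends only on `F|_M`, so `𝒫 X_F` does too, and the
extensions may be taken to be `f ∘ γ`. Their Hamiltonian fields project to `D` along `M`: `d(f ∘ γ)`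
is invariant under `Tγ`, which kills the vertical lifts of `D°`. If `u` and `v` project to `D`, then
`u - 𝒫u` and `v - 𝒫v` are vertical by the first pairing argument, and the vertical space is
isotropic, so `ω(𝒫u, 𝒫v) = ω(u, v)` (`canonicalSymplecticForm_symplecticProjection`). This is the
equality of the two brackets.

Smoothness and the Leibniz rule are checked for the Eden bracket only. Smoothness needs `dq ∧ dp` to
be the same form in all canonical charts (`canonicalSymplecticForm_eq_of_chart`), since the form at
`x` is defined by the chart centred at `x`. -/

noncomputable section

/-! ### Smooth dependence of solutions of linear systems and of linear combinations of sections. -/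

section SmoothCombinations

variable {E₁ : Type*} [NormedAddCommGroup E₁] [NormedSpace ℝ E₁]
  {H₁ : Type*} [TopologicalSpace H₁] {I : ModelWithCorners ℝ E₁ H₁}
  {X : Type*} [TopologicalSpace X] [ChartedSpace H₁ X]
  {ι : Type*} [Fintype ι] {n : WithTop ℕ∞}

theorem ContMDiffAt.matrix_det [DecidableEq ι] {A : X → Matrix ι ι ℝ} {x₀ : X}
    (hA : ∀ i j, ContMDiffAt I 𝓘(ℝ, ℝ) n (fun x => A x i j) x₀) :
    ContMDiffAt I 𝓘(ℝ, ℝ) n (fun x => (A x).det) x₀ := by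
  simp only [Matrix.det_apply']
  exact contMDiffAt_finsetSum fun σ _ =>
    contMDiffAt_const.mul (contMDiffAt_finsetProd fun i _ => hA (σ i) i)

/-- The solution of a linear system with invertible matrix depends smoothly on the data. -/
theorem ContMDiffAt.matrix_inv_mulVec [DecidableEq ι] {A : X → Matrix ι ι ℝ} {b : X → ι → ℝ}
    {x₀ : X} (hA : ∀ i j, ContMDiffAt I 𝓘(ℝ, ℝ) n (fun x => A x i j) x₀)
    (hb : ∀ i, ContMDiffAt I 𝓘(ℝ, ℝ) n (fun x => b x i) x₀) (h0 : (A x₀).det ≠ 0) (i : ι) :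
    ContMDiffAt I 𝓘(ℝ, ℝ) n (fun x => ((A x)⁻¹.mulVec (b x)) i) x₀ := by
  -- Cramer's rule: each coordinate of the solution is a quotient of two determinants in the data.
  have h1 : (fun x => ((A x)⁻¹.mulVec (b x)) i) =
      fun x => (A x).det⁻¹ * ((A x).updateCol i (b x)).det := by
    funext x
    rw [Matrix.inv_def, Matrix.smul_mulVec, ← Matrix.cramer_eq_adjugate_mulVec, Pi.smul_apply,
      Matrix.cramer_apply, Ring.inverse_eq_inv', smul_eq_mul]
  rw [h1]
  refine ((ContMDiffAt.matrix_det hA).inv₀ h0).mul (ContMDiffAt.matrix_det fun a c => ?_)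
  simp only [Matrix.updateCol_apply]
  split_ifs
  · exact hb a
  · exact hA a c

/-- A local trivialization is linear on each fibre, so it carries the combination of sections along
`b` to the same combination of `F`-valued functions. -/
theorem ContMDiffAt.sum_smul_bundle {EB : Type*} [NormedAddCommGroup EB] [NormedSpace ℝ EB]
    {HB : Type*} [TopologicalSpace HB] {IB : ModelWithCorners ℝ EB HB}
    {B : Type*} [TopologicalSpace B] [ChartedSpace HB B]
    {F : Type*} [NormedAddCommGroup F] [NormedSpace ℝ F]
    {V : B → Type*} [TopologicalSpace (TotalSpace F V)] [∀ x, AddCommGroup (V x)]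
    [∀ x, Module ℝ (V x)] [∀ x, TopologicalSpace (V x)] [FiberBundle F V] [VectorBundle ℝ F V]
    {b : X → B} {c : ι → X → ℝ} {s : ι → ∀ x, V (b x)} {x₀ : X}
    (hb : ContMDiffAt I IB n b x₀) (hc : ∀ i, ContMDiffAt I 𝓘(ℝ, ℝ) n (c i) x₀)
    (hs : ∀ i, ContMDiffAt I (IB.prod 𝓘(ℝ, F)) n (fun x => TotalSpace.mk' F (b x) (s i x)) x₀) :
    ContMDiffAt I (IB.prod 𝓘(ℝ, F)) n
      (fun x => TotalSpace.mk' F (b x) (∑ i, c i x • s i x)) x₀ := by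
  rw [contMDiffAt_totalSpace]
  refine ⟨hb, ?_⟩
  have h1 : ContMDiffAt I 𝓘(ℝ, F) n (fun x => ∑ i, c i x •
      (trivializationAt F V (b x₀) (TotalSpace.mk' F (b x) (s i x))).2) x₀ :=
    contMDiffAt_finsetSum fun i _ => (hc i).smul (contMDiffAt_totalSpace.1 (hs i)).2
  refine h1.congr_of_eventuallyEq ?_
  have h2 : ∀ᶠ x in 𝓝 x₀, b x ∈ (trivializationAt F V (b x₀)).baseSet :=
    hb.continuousAt ((trivializationAt F V (b x₀)).open_baseSet.mem_nhds
      (FiberBundle.mem_baseSet_trivializationAt' _))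
  filter_upwards [h2] with x hx
  have h3 : ∀ v, (trivializationAt F V (b x₀) (TotalSpace.mk' F (b x) v)).2 =
      (trivializationAt F V (b x₀)).linearEquivAt ℝ (b x) hx v := fun v => rfl
  simp only [h3, map_sum, map_smul]

end SmoothCombinations

/-! ### The projection `γ` is smooth and provides extensions of functions on `M`. -/

section EdenProjection

variable {E : Type*} [NormedAddCommGroup E] [NormedSpace ℝ E] [FiniteDimensional ℝ E]
  {Q : Type*} [TopologicalSpace Q] [ChartedSpace E Q] [IsManifold 𝓘(ℝ, E) ∞ Q]
  {k : ℕ} (g : SmoothMetric E Q) (D : SmoothDistribution E Q k)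

/-- The projection `γ`, viewed as a map `T*Q → T*Q`. -/
def edenEndomorphism (x : CotangentBundle E Q) : CotangentBundle E Q :=
  (edenProjection g D x).1

/-- The difference `α - m` lies in `D°`, the kernel of the projection. This recognises `γ(α)` by two
properties: it lies in `M`, and it agrees with `α` on `D`. -/
theorem edenProjectionFiber_eq {q : Q} {α m : CotangentSpace E q}
    (hm : m ∈ constraintFiber g D q) (hα : ∀ v ∈ D.fiber q, α v = m v) :
    (edenProjectionFiber g D q α : CotangentSpace E q) = m := by
  have h1 : α - m ∈ annihilatorFiber D q := fun v hv => by
    rw [sub_apply, hα v hv, sub_self]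
  have h2 : edenProjectionFiber g D q (α - m) = 0 :=
    (Submodule.projectionOnto_apply_eq_zero_iff (isCompl_constraintFiber g D q)).2 h1
  have h3 : edenProjectionFiber g D q m = ⟨m, hm⟩ :=
    Submodule.projectionOnto_apply_left (isCompl_constraintFiber g D q) ⟨m, hm⟩
  rw [map_sub, sub_eq_zero] at h2
  rw [h2, h3]

theorem edenProjectionFiber_apply_of_mem {q : Q} (α : CotangentSpace E q)
    {v : TangentSpace 𝓘(ℝ, E) q} (hv : v ∈ D.fiber q) :
    (edenProjectionFiber g D q α : CotangentSpace E q) v = α v := by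
  have h := (isCompl_constraintFiber g D q).sup_eq_top
  obtain ⟨m, hm, r, hr, rfl⟩ := Submodule.mem_sup.1 (h.symm ▸ Submodule.mem_top : α ∈ _)
  have h1 : ∀ v ∈ D.fiber q, (m + r) v = m v := fun v hv => by
    rw [add_apply, hr v hv, add_zero]
  rw [edenProjectionFiber_eq g D hm h1, h1 v hv]

theorem edenEndomorphism_of_mem {x : CotangentBundle E Q} (hx : x ∈ constraintSubmanifold g D) :
    edenEndomorphism g D x = x := by
  obtain ⟨q, α⟩ := x
  exact congrArg (TotalSpace.mk q) (edenProjectionFiber_eq g D hx fun _ _ => rfl)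

theorem edenProjection_of_mem (x : constraintSubmanifold g D) : edenProjection g D x = x :=
  Subtype.ext (edenEndomorphism_of_mem g D x.2)

theorem edenEndomorphism_mem (x : CotangentBundle E Q) :
    edenEndomorphism g D x ∈ constraintSubmanifold g D :=
  (edenProjection g D x).2

/-- The Gram matrix of a family of tangent vectors. -/
def gramMatrix {q : Q} (X : Fin k → TangentSpace 𝓘(ℝ, E) q) : Matrix (Fin k) (Fin k) ℝ :=
  fun i j => g.inner q (X j) (X i)

/-- A kernel vector `c` of the Gram matrix makes `∑ c j • X j` orthogonal to every `X i`, hence to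
itself, hence zero. The `k` vectors are independent because they span a space of dimension `k`. -/
theorem det_gramMatrix_ne_zero {q : Q} {X : Fin k → TangentSpace 𝓘(ℝ, E) q}
    (hX : D.fiber q = Submodule.span ℝ (Set.range X)) : (gramMatrix g X).det ≠ 0 := by
  have hli : LinearIndependent ℝ X := by
    rw [linearIndependent_iff_card_eq_finrank_span, Set.finrank, ← hX, D.finrank_fiber,
      Fintype.card_fin]
  intro h0
  obtain ⟨c, hc, hc0⟩ := Matrix.exists_mulVec_eq_zero_iff.2 h0
  have h1 : ∀ i, g.inner q (∑ j, c j • X j) (X i) = 0 := fun i => by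
    have := congrFun hc0 i
    simp only [Matrix.mulVec, dotProduct, gramMatrix, Pi.zero_apply] at this
    simp only [map_sum, map_smul, sum_apply, smul_apply, smul_eq_mul]
    rw [← this]
    exact Finset.sum_congr rfl fun j _ => mul_comm _ _
  have h2 : g.inner q (∑ j, c j • X j) (∑ j, c j • X j) = 0 := by
    simp only [map_sum, map_smul] at h1 ⊢
    simp [h1]
  have h3 : ∑ j, c j • X j = 0 := by
    by_contra hne
    exact (g.pos q _ hne).ne' h2
  exact hc (funext (Fintype.linearIndependent_iff.1 hli c h3))

/-- The coefficients solve the normal equations: the Gram matrix times `c` is the vector of values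
`α (X i)`, so the sum agrees with `α` on the frame and hence on `D`. -/
theorem edenProjectionFiber_eq_sum {q : Q} {X : Fin k → TangentSpace 𝓘(ℝ, E) q}
    (hX : D.fiber q = Submodule.span ℝ (Set.range X)) (α : CotangentSpace E q) :
    (edenProjectionFiber g D q α : CotangentSpace E q) =
      ∑ j, ((gramMatrix g X)⁻¹.mulVec fun i => α (X i)) j • g.inner q (X j) := by
  set c := (gramMatrix g X)⁻¹.mulVec fun i => α (X i) with hc
  have hmem : ∀ i, X i ∈ D.fiber q := fun i => hX ▸ Submodule.subset_span ⟨i, rfl⟩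
  have h1 : (gramMatrix g X).mulVec c = fun i => α (X i) := by
    rw [hc, Matrix.mulVec_mulVec,
      Matrix.mul_nonsing_inv _ (isUnit_iff_ne_zero.2 (det_gramMatrix_ne_zero g D hX)),
      Matrix.one_mulVec]
  apply edenProjectionFiber_eq
  · exact Submodule.sum_mem _ fun j _ => Submodule.smul_mem _ _ ⟨X j, hmem j, rfl⟩
  · intro v hv
    rw [hX] at hv
    induction hv using Submodule.span_induction with
    | mem v hv =>
      obtain ⟨i, rfl⟩ := hv
      have := congrFun h1 i
      simp only [Matrix.mulVec, dotProduct, gramMatrix] at this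
      rw [← this]
      simp only [sum_apply, smul_apply, smul_eq_mul]
      exact Finset.sum_congr rfl fun j _ => mul_comm _ _
    | zero => rw [map_zero, map_zero]
    | add v w _ _ hv hw => rw [map_add, map_add, hv, hw]
    | smul a v _ hv => rw [map_smul, map_smul, hv]

theorem contMDiff_edenEndomorphism :
    ContMDiff (cotangentModel E) (cotangentModel E) ∞ (edenEndomorphism g D) := by
  intro x₀
  obtain ⟨U, hU, hxU, X, hX, hspan⟩ := D.exists_local_frame x₀.proj
  have hπ : ContMDiffAt (cotangentModel E) 𝓘(ℝ, E) ∞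
      (fun y : CotangentBundle E Q => y.proj) x₀ := contMDiff_proj _ x₀
  have hXi : ∀ i, ContMDiffAt (cotangentModel E) (𝓘(ℝ, E).prod 𝓘(ℝ, E)) ∞
      (fun y : CotangentBundle E Q =>
        (TotalSpace.mk' E y.proj (X i y.proj) : TangentBundle 𝓘(ℝ, E) Q)) x₀ := fun i =>
    ((hX i).contMDiffAt (hU.mem_nhds hxU)).comp x₀ hπ
  have hg : ContMDiffAt (cotangentModel E) (𝓘(ℝ, E).prod 𝓘(ℝ, E →L[ℝ] E →L[ℝ] ℝ)) ∞
      (fun y : CotangentBundle E Q => TotalSpace.mk' (E →L[ℝ] E →L[ℝ] ℝ)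
        (E := fun q : Q => TangentSpace 𝓘(ℝ, E) q →L[ℝ] TangentSpace 𝓘(ℝ, E) q →L[ℝ]
          Bundle.Trivial Q ℝ q) y.proj (g.inner y.proj)) x₀ :=
    (g.contMDiff x₀.proj).comp x₀ hπ
  have hid : ContMDiffAt (cotangentModel E) (𝓘(ℝ, E).prod 𝓘(ℝ, E →L[ℝ] ℝ)) ∞
      (fun y : CotangentBundle E Q => TotalSpace.mk' (E →L[ℝ] ℝ)
        (E := fun q : Q => TangentSpace 𝓘(ℝ, E) q →L[ℝ] Bundle.Trivial Q ℝ q) y.proj y.2) x₀ :=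
    contMDiffAt_id
  have hflat : ∀ i, ContMDiffAt (cotangentModel E) (𝓘(ℝ, E).prod 𝓘(ℝ, E →L[ℝ] ℝ)) ∞
      (fun y : CotangentBundle E Q => TotalSpace.mk' (E →L[ℝ] ℝ)
        (E := fun q : Q => TangentSpace 𝓘(ℝ, E) q →L[ℝ] Bundle.Trivial Q ℝ q) y.proj
        (g.inner y.proj (X i y.proj))) x₀ := fun i =>
    hg.clm_bundle_apply (hXi i)
  have hgram : ∀ i j, ContMDiffAt (cotangentModel E) 𝓘(ℝ, ℝ) ∞
      (fun y : CotangentBundle E Q => gramMatrix g (fun i => X i y.proj) i j) x₀ := by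
    intro i j
    have h : ContMDiffAt (cotangentModel E) (𝓘(ℝ, E).prod 𝓘(ℝ, ℝ)) ∞
        (fun y : CotangentBundle E Q => TotalSpace.mk' ℝ (E := Bundle.Trivial Q ℝ) y.proj
          (g.inner y.proj (X j y.proj) (X i y.proj))) x₀ :=
      (hflat j).clm_bundle_apply (hXi i)
    exact (contMDiffAt_totalSpace.1 h).2
  have hpair : ∀ i, ContMDiffAt (cotangentModel E) 𝓘(ℝ, ℝ) ∞
      (fun y : CotangentBundle E Q => y.2 (X i y.proj)) x₀ := fun i =>
    (contMDiffAt_totalSpace.1 (hid.clm_bundle_apply (hXi i))).2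
  refine (ContMDiffAt.sum_smul_bundle hπ (fun j => ContMDiffAt.matrix_inv_mulVec hgram hpair
    (det_gramMatrix_ne_zero g D (hspan _ hxU)) j) hflat).congr_of_eventuallyEq ?_
  filter_upwards [hπ.continuousAt (hU.mem_nhds hxU)] with y hy
  exact congrArg (TotalSpace.mk y.proj) (edenProjectionFiber_eq_sum g D (hspan _ hy) y.2)

/-- A smooth function `f` on `M` has the smooth extension `f ∘ γ`. -/
theorem isSmoothExtension_comp_edenProjection
    (f : smoothFunctions (cotangentModel E) (constraintSubmanifold g D)) :
    IsSmoothExtension (cotangentModel E) f.1 (fun y => f.1 (edenProjection g D y)) := by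
  refine ⟨fun y => ?_, fun x => congrArg f.1 (edenProjection_of_mem g D x)⟩
  obtain ⟨U, hU, hyU, F, hF, hFf⟩ := f.2 (edenProjection g D y)
  have hΓ := contMDiff_edenEndomorphism g D y
  refine ((hF.contMDiffAt (hU.mem_nhds hyU)).comp y hΓ).congr_of_eventuallyEq ?_
  filter_upwards [hΓ.continuousAt (hU.mem_nhds hyU)] with z hz
  exact (hFf (edenProjection g D z) hz).symm

end EdenProjection

/-! ### Chart invariance of `dq ∧ dp` and smoothness of the canonical Poisson bracket. -/

section CanonicalCoordinates

variable {E : Type*} [NormedAddCommGroup E] [NormedSpace ℝ E] [FiniteDimensional ℝ E]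
  {Q : Type*} [TopologicalSpace Q] [ChartedSpace E Q] [IsManifold 𝓘(ℝ, E) ∞ Q]

theorem contDiffAt_transition {q₀ q₁ q : Q} (h₀ : q ∈ (extChartAt 𝓘(ℝ, E) q₀).source)
    (h₁ : q ∈ (extChartAt 𝓘(ℝ, E) q₁).source) :
    ContDiffAt ℝ ∞ (extChartAt 𝓘(ℝ, E) q₁ ∘ (extChartAt 𝓘(ℝ, E) q₀).symm)
      (extChartAt 𝓘(ℝ, E) q₀ q) := by
  rw [← contMDiffAt_iff_contDiffAt]
  have h2 : ContMDiffAt 𝓘(ℝ, E) 𝓘(ℝ, E) ∞ (extChartAt 𝓘(ℝ, E) q₀).symm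
      (extChartAt 𝓘(ℝ, E) q₀ q) :=
    (contMDiffOn_extChartAt_symm q₀).contMDiffAt
      (extChartAt_target_mem_nhds' ((extChartAt 𝓘(ℝ, E) q₀).map_source h₀))
  refine ContMDiffAt.comp _ ?_ h2
  rw [(extChartAt 𝓘(ℝ, E) q₀).left_inv h₀]
  exact contMDiffAt_extChartAt' (by rwa [extChartAt_source] at h₁)

theorem fderiv_transition_comp_mfderiv {q₀ q₁ q : Q} (h₀ : q ∈ (extChartAt 𝓘(ℝ, E) q₀).source)
    (h₁ : q ∈ (extChartAt 𝓘(ℝ, E) q₁).source) :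
    (fderiv ℝ (extChartAt 𝓘(ℝ, E) q₁ ∘ (extChartAt 𝓘(ℝ, E) q₀).symm)
        (extChartAt 𝓘(ℝ, E) q₀ q)).comp (mfderiv 𝓘(ℝ, E) 𝓘(ℝ, E) (extChartAt 𝓘(ℝ, E) q₀) q) =
      mfderiv 𝓘(ℝ, E) 𝓘(ℝ, E) (extChartAt 𝓘(ℝ, E) q₁) q := by
  have h2 := ((contDiffAt_transition h₀ h₁).differentiableAt (by simp)).hasFDerivAt
  have h3 := (mdifferentiableAt_extChartAt (I := 𝓘(ℝ, E))
    (by rwa [extChartAt_source] at h₀ : q ∈ (chartAt E q₀).source)).hasMFDerivAt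
  have h4 := h2.hasMFDerivAt.comp q h3
  refine (h4.congr_of_eventuallyEq ?_).mfderiv.symm
  filter_upwards [extChartAt_source_mem_nhds' (I := 𝓘(ℝ, E)) h₀] with z hz
  exact congrArg (extChartAt 𝓘(ℝ, E) q₁) ((extChartAt 𝓘(ℝ, E) q₀).left_inv hz).symm

/-- The transformation law of the momentum coordinates. -/
theorem pCoord_transition {x₀ x₁ z : CotangentBundle E Q}
    (h₀ : z.proj ∈ (extChartAt 𝓘(ℝ, E) x₀.proj).source)
    (h₁ : z.proj ∈ (extChartAt 𝓘(ℝ, E) x₁.proj).source) :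
    pCoord x₀ z = (pCoord x₁ z).comp
      (fderiv ℝ (extChartAt 𝓘(ℝ, E) x₁.proj ∘ (extChartAt 𝓘(ℝ, E) x₀.proj).symm)
        (qCoord x₀ z)) := by
  have hc := fderiv_transition_comp_mfderiv h₀ h₁
  have hi₀ := isInvertible_mfderiv_extChartAt (I := 𝓘(ℝ, E)) h₀
  have hi₁ := isInvertible_mfderiv_extChartAt (I := 𝓘(ℝ, E)) h₁
  ext w
  obtain ⟨w', rfl⟩ : ∃ w', mfderiv 𝓘(ℝ, E) 𝓘(ℝ, E) (extChartAt 𝓘(ℝ, E) x₀.proj) z.proj w' = w :=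
    ⟨_, hi₀.self_apply_inverse w⟩
  have h3 : pCoord x₀ z (mfderiv 𝓘(ℝ, E) 𝓘(ℝ, E) (extChartAt 𝓘(ℝ, E) x₀.proj) z.proj w') =
      z.2 w' := congrArg z.2 (hi₀.inverse_apply_self w')
  have h4 : pCoord x₁ z (mfderiv 𝓘(ℝ, E) 𝓘(ℝ, E) (extChartAt 𝓘(ℝ, E) x₁.proj) z.proj w') =
      z.2 w' := congrArg z.2 (hi₁.inverse_apply_self w')
  exact h3.trans (h4.symm.trans (congrArg (pCoord x₁ z) (DFunLike.congr_fun hc w').symm))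

theorem mem_extChartAt_source_cotangent_iff {x₀ z : CotangentBundle E Q} :
    z ∈ (extChartAt (cotangentModel E) x₀).source ↔
      z.proj ∈ (extChartAt 𝓘(ℝ, E) x₀.proj).source := by
  rw [extChartAt_source, extChartAt_source]
  simp only [FiberBundle.chartedSpace_chartAt, mfld_simps,
    TangentBundle.trivializationAt_baseSet]
  refine ⟨fun h => h.1.1, fun h => ⟨⟨h, trivial⟩, ?_⟩⟩
  rwa [Trivialization.coe_fst' _ (by simpa [hom_trivializationAt_baseSet] using h)]

/-- The expression `dq ∧ dp` for the symplectic form is valid in all canonical charts. -/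
theorem canonicalSymplecticForm_eq_of_chart {x₀ y : CotangentBundle E Q}
    (hy : y ∈ (extChartAt (cotangentModel E) x₀).source)
    (T : TangentSpace (cotangentModel E) y →L[ℝ] E × (E →L[ℝ] ℝ))
    (hT : T = mfderiv (cotangentModel E) 𝓘(ℝ, E × (E →L[ℝ] ℝ))
      (extChartAt (cotangentModel E) x₀) y) (u v : TangentSpace (cotangentModel E) y) :
    canonicalSymplecticForm y u v = (T v).2 (T u).1 - (T u).2 (T v).1 := by
  -- `e` is the chart used to define the form at `y`, `e₀` is the chart to compare with, and `ψ` is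
  -- the change of position coordinates from `e` to `e₀`.
  set e := extChartAt (cotangentModel E) y with he
  set e₀ := extChartAt (cotangentModel E) x₀ with he₀
  set ψ := extChartAt 𝓘(ℝ, E) x₀.proj ∘ (extChartAt 𝓘(ℝ, E) y.proj).symm with hψ
  have hyb := mem_extChartAt_source_cotangent_iff.1 hy
  have hyy := mem_extChartAt_source (I := 𝓘(ℝ, E)) y.proj
  have hde : HasMFDerivAt (cotangentModel E) 𝓘(ℝ, E × (E →L[ℝ] ℝ)) e y
      (ContinuousLinearMap.id ℝ (E × (E →L[ℝ] ℝ))) := by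
    have := (mdifferentiableAt_extChartAt (I := cotangentModel E)
      (mem_chart_source _ y)).hasMFDerivAt
    rwa [mfderiv_extChartAt_self] at this
  have hde₀ : HasMFDerivAt (cotangentModel E) 𝓘(ℝ, E × (E →L[ℝ] ℝ)) e₀ y T := by
    rw [hT]
    exact (mdifferentiableAt_extChartAt (I := cotangentModel E)
      (by rwa [he₀, extChartAt_source] at hy)).hasMFDerivAt
  have hsrc : ∀ᶠ z in 𝓝 y, z ∈ e₀.source ∧ z ∈ e.source :=
    Filter.inter_mem (extChartAt_source_mem_nhds' hy) (extChartAt_source_mem_nhds y)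
  have hcoord : ∀ᶠ z in 𝓝 y, e z = (qCoord y z, pCoord y z) ∧ e₀ z = (qCoord x₀ z, pCoord x₀ z) ∧
      (e₀ z).1 = ψ (e z).1 ∧ (e z).2 = (e₀ z).2.comp (fderiv ℝ ψ (e z).1) := by
    filter_upwards [hsrc] with z hz
    have h₀ := mem_extChartAt_source_cotangent_iff.1 hz.1
    have h₁ := mem_extChartAt_source_cotangent_iff.1 hz.2
    have hz₀ := extChartAt_cotangentBundle x₀ z (by rwa [extChartAt_source] at h₀)
    have hz₁ := extChartAt_cotangentBundle y z (by rwa [extChartAt_source] at h₁)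
    refine ⟨hz₁, hz₀, ?_, ?_⟩
    · rw [he, he₀, hz₀, hz₁]
      exact congrArg (extChartAt 𝓘(ℝ, E) x₀.proj)
        ((extChartAt 𝓘(ℝ, E) y.proj).left_inv h₁).symm
    · rw [he, he₀, hz₀, hz₁]
      exact pCoord_transition h₁ h₀
  have hψs : ContDiffAt ℝ ∞ ψ (e y).1 := by
    rw [hcoord.self_of_nhds.1]
    exact contDiffAt_transition hyy hyb
  have hψ1 := (hψs.differentiableAt (by simp)).hasFDerivAt
  have hψ2 := (((hψs.fderiv_right (m := ∞) (by simp)).differentiableAt (by simp))).hasFDerivAt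
  have hsymm := hψs.isSymmSndFDerivAt (by
    rw [minSmoothness_of_isRCLikeNormedField]; exact WithTop.coe_le_coe.2 le_top)
  -- the derivative of the relation between the position coordinates
  have hq : ∀ w : E × (E →L[ℝ] ℝ), (T w).1 = fderiv ℝ ψ (e y).1 w.1 := by
    have h1 := (ContinuousLinearMap.fst ℝ E (E →L[ℝ] ℝ)).hasMFDerivAt (x := e₀ y) |>.comp y hde₀
    have h2 := (hψ1.comp (e y) (ContinuousLinearMap.fst ℝ E (E →L[ℝ] ℝ)).hasFDerivAt).hasMFDerivAt
      |>.comp y hde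
    have h3 := hasMFDerivAt_unique h1 (h2.congr_of_eventuallyEq
      (hcoord.mono fun z hz => hz.2.2.1))
    exact fun w => DFunLike.congr_fun h3 w
  -- the derivative of the relation between the momentum coordinates
  have hp : ∀ w : E × (E →L[ℝ] ℝ), w.2 = (T w).2.comp (fderiv ℝ ψ (e y).1) +
      (e₀ y).2.comp (fderiv ℝ (fderiv ℝ ψ) (e y).1 w.1) := by
    have h1 := (ContinuousLinearMap.snd ℝ E (E →L[ℝ] ℝ)).hasMFDerivAt (x := e y) |>.comp y hde
    -- The relation `p = p₀ ∘ Dψ(q)` is a product of two factors depending on the point; the product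
    -- rule yields the term with `D²ψ`.
    have hH : HasFDerivAt (fun s : (E × (E →L[ℝ] ℝ)) × (E × (E →L[ℝ] ℝ)) =>
        s.1.2.comp (fderiv ℝ ψ s.2.1)) _ (e₀ y, e y) :=
      ((ContinuousLinearMap.snd ℝ E (E →L[ℝ] ℝ)).comp
        (ContinuousLinearMap.fst ℝ _ (E × (E →L[ℝ] ℝ)))).hasFDerivAt.clm_comp
      (hψ2.comp (e₀ y, e y) ((ContinuousLinearMap.fst ℝ E (E →L[ℝ] ℝ)).comp
        (ContinuousLinearMap.snd ℝ (E × (E →L[ℝ] ℝ)) _)).hasFDerivAt)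
    have hpair : HasMFDerivAt (cotangentModel E) 𝓘(ℝ, (E × (E →L[ℝ] ℝ)) × (E × (E →L[ℝ] ℝ)))
        (fun z => (e₀ z, e z)) y (T.prod (ContinuousLinearMap.id ℝ (E × (E →L[ℝ] ℝ)))) :=
      ⟨hde₀.1.prodMk hde.1, hde₀.2.prodMk hde.2⟩
    have h2 := HasMFDerivAt.comp (f := fun z => (e₀ z, e z)) y hH.hasMFDerivAt hpair
    have h3 := hasMFDerivAt_unique h1 (h2.congr_of_eventuallyEq
      (hcoord.mono fun z hz => hz.2.2.2))
    intro w
    refine (DFunLike.congr_fun h3 w).trans ?_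
    exact add_comm _ _
  have hω := canonicalSymplecticForm_apply y u v
  rw [hω]
  have hu := hp u
  have hv := hp v
  have hv' := DFunLike.congr_fun hv (u : E × (E →L[ℝ] ℝ)).1
  have hu' := DFunLike.congr_fun hu (v : E × (E →L[ℝ] ℝ)).1
  simp only [add_apply, ContinuousLinearMap.comp_apply] at hu' hv'
  -- The two `D²ψ` terms, evaluated on `(u.1, v.1)` and on `(v.1, u.1)`, cancel by symmetry of the
  -- second derivative.
  rw [hv', hu', hq u, hq v, hsymm (v : E × (E →L[ℝ] ℝ)).1 (u : E × (E →L[ℝ] ℝ)).1]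
  ring

theorem canonicalSymplecticForm_hamiltonianVectorField (F : CotangentBundle E Q → ℝ)
    (x : CotangentBundle E Q) (v : TangentSpace (cotangentModel E) x) :
    canonicalSymplecticForm x (hamiltonianVectorField F x) v = functionDifferential F x v :=
  LinearMap.BilinForm.apply_toDual_symm_apply _ _

/-- The canonical Poisson bracket of two linear forms on `E × E*`. -/
def linearPoissonBracket (L L' : E × (E →L[ℝ] ℝ) →L[ℝ] ℝ) : ℝ :=
  L' (0, L.comp (ContinuousLinearMap.inl ℝ E (E →L[ℝ] ℝ))) -
    L (0, L'.comp (ContinuousLinearMap.inl ℝ E (E →L[ℝ] ℝ)))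

theorem contDiffAt_comp_extChartAt_symm {x₀ y : CotangentBundle E Q}
    (hy : y ∈ (extChartAt (cotangentModel E) x₀).source) {F : CotangentBundle E Q → ℝ}
    (hF : ContMDiffAt (cotangentModel E) 𝓘(ℝ, ℝ) ∞ F y) :
    ContDiffAt ℝ ∞ (F ∘ (extChartAt (cotangentModel E) x₀).symm)
      (extChartAt (cotangentModel E) x₀ y) := by
  rw [← contMDiffAt_iff_contDiffAt]
  have h1 : ContMDiffAt 𝓘(ℝ, E × (E →L[ℝ] ℝ)) (cotangentModel E) ∞
      (extChartAt (cotangentModel E) x₀).symm (extChartAt (cotangentModel E) x₀ y) :=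
    (contMDiffOn_extChartAt_symm x₀).contMDiffAt
      (extChartAt_target_mem_nhds' ((extChartAt (cotangentModel E) x₀).map_source hy))
  refine ContMDiffAt.comp _ ?_ h1
  rwa [(extChartAt (cotangentModel E) x₀).left_inv hy]

theorem functionDifferential_eq_of_chart {x₀ y : CotangentBundle E Q}
    (hy : y ∈ (extChartAt (cotangentModel E) x₀).source) {F : CotangentBundle E Q → ℝ}
    (hF : ContMDiffAt (cotangentModel E) 𝓘(ℝ, ℝ) ∞ F y)
    (v : TangentSpace (cotangentModel E) y) :
    functionDifferential F y v =
      fderiv ℝ (F ∘ (extChartAt (cotangentModel E) x₀).symm) (extChartAt (cotangentModel E) x₀ y)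
        (mfderiv (cotangentModel E) 𝓘(ℝ, E × (E →L[ℝ] ℝ))
          (extChartAt (cotangentModel E) x₀) y v) := by
  have h1 := ((contDiffAt_comp_extChartAt_symm hy hF).differentiableAt (by simp)).hasFDerivAt
  have h2 := (mdifferentiableAt_extChartAt (I := cotangentModel E)
    (by rwa [extChartAt_source] at hy)).hasMFDerivAt
  have h3 := h1.hasMFDerivAt.comp y h2
  refine DFunLike.congr_fun (h3.congr_of_eventuallyEq ?_).mfderiv v
  filter_upwards [extChartAt_source_mem_nhds' (I := cotangentModel E) hy] with z hz
  exact congrArg F ((extChartAt (cotangentModel E) x₀).left_inv hz).symm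

/-- Solving `i_X ω = dF` in the coordinates of a fixed chart `x₀` expresses the bracket through
coordinate derivatives. Since `x₀` stays fixed while `y` moves, the smoothness of the bracket can be
read off. -/
theorem canonicalBracket_eq_of_chart {x₀ y : CotangentBundle E Q}
    (hy : y ∈ (extChartAt (cotangentModel E) x₀).source) {F G : CotangentBundle E Q → ℝ}
    (hF : ContMDiffAt (cotangentModel E) 𝓘(ℝ, ℝ) ∞ F y)
    (hG : ContMDiffAt (cotangentModel E) 𝓘(ℝ, ℝ) ∞ G y) :
    canonicalBracket F G y = linearPoissonBracket
      (fderiv ℝ (F ∘ (extChartAt (cotangentModel E) x₀).symm) (extChartAt (cotangentModel E) x₀ y))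
      (fderiv ℝ (G ∘ (extChartAt (cotangentModel E) x₀).symm)
        (extChartAt (cotangentModel E) x₀ y)) := by
  obtain ⟨T, hT⟩ : ∃ T : TangentSpace (cotangentModel E) y →L[ℝ] E × (E →L[ℝ] ℝ),
      T = mfderiv (cotangentModel E) 𝓘(ℝ, E × (E →L[ℝ] ℝ))
        (extChartAt (cotangentModel E) x₀) y := ⟨_, rfl⟩
  have hsurj : ∀ w : E × (E →L[ℝ] ℝ), ∃ v, T v = w := fun w => by
    rw [hT]
    exact ⟨_, (isInvertible_mfderiv_extChartAt (I := cotangentModel E) hy).self_apply_inverse w⟩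
  have key : ∀ {F : CotangentBundle E Q → ℝ}, ContMDiffAt (cotangentModel E) 𝓘(ℝ, ℝ) ∞ F y →
      ∀ w : E × (E →L[ℝ] ℝ), w.2 (T (hamiltonianVectorField F y)).1 -
        (T (hamiltonianVectorField F y)).2 w.1 =
        fderiv ℝ (F ∘ (extChartAt (cotangentModel E) x₀).symm)
          (extChartAt (cotangentModel E) x₀ y) w := by
    intro F hF w
    obtain ⟨v, rfl⟩ := hsurj w
    rw [← canonicalSymplecticForm_eq_of_chart hy T hT,
      canonicalSymplecticForm_hamiltonianVectorField, functionDifferential_eq_of_chart hy hF, hT]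
    rfl
  have key₂ : ∀ {F : CotangentBundle E Q → ℝ}, ContMDiffAt (cotangentModel E) 𝓘(ℝ, ℝ) ∞ F y →
      ∀ w : E, (T (hamiltonianVectorField F y)).2 w =
        -fderiv ℝ (F ∘ (extChartAt (cotangentModel E) x₀).symm)
          (extChartAt (cotangentModel E) x₀ y) (w, 0) := by
    intro F hF w
    have := key hF (w, 0)
    rw [zero_apply] at this
    linarith
  -- Testing `dF` on the vertical vector whose momentum part is `∂G/∂q` gives the pairing of `∂G/∂q`
  -- with the position part of `X_F`; the next line exchanges `F` and `G`.
  have hF' := key hF (0, (fderiv ℝ (G ∘ (extChartAt (cotangentModel E) x₀).symm)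
    (extChartAt (cotangentModel E) x₀ y)).comp (ContinuousLinearMap.inl ℝ E (E →L[ℝ] ℝ)))
  have hG' := key hG (0, (fderiv ℝ (F ∘ (extChartAt (cotangentModel E) x₀).symm)
    (extChartAt (cotangentModel E) x₀ y)).comp (ContinuousLinearMap.inl ℝ E (E →L[ℝ] ℝ)))
  rw [map_zero, sub_zero] at hF' hG'
  rw [canonicalBracket, canonicalSymplecticForm_eq_of_chart hy T hT, key₂ hF, key₂ hG,
    linearPoissonBracket, ← hF', ← hG', ContinuousLinearMap.comp_apply,
    ContinuousLinearMap.comp_apply, ContinuousLinearMap.inl_apply, ContinuousLinearMap.inl_apply]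
  ring

theorem contMDiff_canonicalBracket {F G : CotangentBundle E Q → ℝ}
    (hF : ContMDiff (cotangentModel E) 𝓘(ℝ, ℝ) ∞ F)
    (hG : ContMDiff (cotangentModel E) 𝓘(ℝ, ℝ) ∞ G) :
    ContMDiff (cotangentModel E) 𝓘(ℝ, ℝ) ∞ (canonicalBracket F G) := by
  intro x₀
  have hx := mem_extChartAt_source (I := cotangentModel E) x₀
  have hF' := (contDiffAt_comp_extChartAt_symm hx (hF x₀)).fderiv_right (m := ∞) (by simp)
  have hG' := (contDiffAt_comp_extChartAt_symm hx (hG x₀)).fderiv_right (m := ∞) (by simp)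
  have h1 : ContDiffAt ℝ ∞ (fun w => linearPoissonBracket
      (fderiv ℝ (F ∘ (extChartAt (cotangentModel E) x₀).symm) w)
      (fderiv ℝ (G ∘ (extChartAt (cotangentModel E) x₀).symm) w))
      (extChartAt (cotangentModel E) x₀ x₀) :=
    (hG'.clm_apply (contDiffAt_const.prodMk (hF'.clm_comp contDiffAt_const))).sub
      (hF'.clm_apply (contDiffAt_const.prodMk (hG'.clm_comp contDiffAt_const)))
  refine (h1.contMDiffAt.comp x₀ contMDiffAt_extChartAt).congr_of_eventuallyEq ?_
  filter_upwards [extChartAt_source_mem_nhds (I := cotangentModel E) x₀] with y hy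
  exact canonicalBracket_eq_of_chart hy (hF y) (hG y)

end CanonicalCoordinates

/-! ### Linear algebra of the symplectic splitting at one point. -/

section LinearAlgebra

variable {E : Type*} [NormedAddCommGroup E] [NormedSpace ℝ E]

/-- The properties of the derivative `T` of `γ` at a point of `M`, as an endomorphism of
`T_x(T*Q) = E × E*`: it is an idempotent which covers the identity of `E`, and on the vertical
space it is the projection onto `b(D)` along the annihilator of `D`. -/
structure IsProjectionDerivative (b : E →L[ℝ] E →L[ℝ] ℝ) (D : Submodule ℝ E)
    (T : E × (E →L[ℝ] ℝ) →L[ℝ] E × (E →L[ℝ] ℝ)) : Prop where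
  pos : ∀ v, v ≠ 0 → 0 < b v v
  fst_apply : ∀ v, (T v).1 = v.1
  idem : ∀ v, T (T v) = T v
  vertical_apply : ∀ p, ∀ u ∈ D, (T (0, p)).2 u = p u
  vertical_range : ∀ p, ∃ d ∈ D, (T (0, p)).2 = b d
  vertical_fix : ∀ d ∈ D, T (0, b d) = (0, b d)

namespace IsProjectionDerivative

variable {b : E →L[ℝ] E →L[ℝ] ℝ} {D : Submodule ℝ E}
  {T : E × (E →L[ℝ] ℝ) →L[ℝ] E × (E →L[ℝ] ℝ)}

theorem eq_zero_of_apply_self (hT : IsProjectionDerivative b D T) {v : E} (h : b v v = 0) :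
    v = 0 := by
  by_contra hne
  exact (hT.pos v hne).ne' h

/-- The vertical vector `(0, b v.1)` lies in `W`, and its pairing with `v` is `-b v.1 v.1`.
Membership of `v` in `W` is not required, so this also applies to `u - 𝒫u`. -/
theorem fst_eq_zero_of_orthogonal (hT : IsProjectionDerivative b D T)
    {W : Submodule ℝ (E × (E →L[ℝ] ℝ))} (hW : ∀ v, v ∈ W ↔ T v = v ∧ v.1 ∈ D)
    {v : E × (E →L[ℝ] ℝ)} (hv : v.1 ∈ D) (h : ∀ w ∈ W, v.2 w.1 - w.2 v.1 = 0) : v.1 = 0 := by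
  have h1 := h (0, b v.1) ((hW _).2 ⟨hT.vertical_fix _ hv, D.zero_mem⟩)
  rw [map_zero, zero_sub, neg_eq_zero] at h1
  exact hT.eq_zero_of_apply_self h1

/-- Once the base component vanishes, `v` is vertical and fixed by `T`, so `v = (0, b d)` with `d ∈
D`. The vector `T (d, 0)` of `W` has base component `d` and pairs with `v` to `b d d`. -/
theorem eq_zero_of_mem_of_orthogonal (hT : IsProjectionDerivative b D T)
    {W : Submodule ℝ (E × (E →L[ℝ] ℝ))} (hW : ∀ v, v ∈ W ↔ T v = v ∧ v.1 ∈ D)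
    {v : E × (E →L[ℝ] ℝ)} (hv : v ∈ W) (h : ∀ w ∈ W, v.2 w.1 - w.2 v.1 = 0) : v = 0 := by
  have h1 : v.1 = 0 := hT.fst_eq_zero_of_orthogonal hW ((hW v).1 hv).2 h
  obtain ⟨d, hd, hvd⟩ := hT.vertical_range v.2
  have h2 : v.2 = b d := by
    rw [← hvd, ← h1, Prod.mk.eta, ((hW v).1 hv).1]
  have h3 := h (T (d, 0)) ((hW _).2 ⟨hT.idem _, by rwa [hT.fst_apply]⟩)
  rw [hT.fst_apply, h1, map_zero, sub_zero, h2] at h3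
  refine Prod.ext h1 ?_
  rw [h2, hT.eq_zero_of_apply_self h3, map_zero, Prod.snd_zero]

/-- For `p` in the annihilator of `D`, `T (0, p) = (0, b d)` with `b d d = p d = 0`, so `T` kills
`(0, p)` and `p a = L (0, p) = 0`. In the application `a` is the base component of `X_F` and `L =
dF`. -/
theorem mem_of_invariant [FiniteDimensional ℝ E] (hT : IsProjectionDerivative b D T) {a : E}
    {L : E × (E →L[ℝ] ℝ) →L[ℝ] ℝ} (hL : ∀ v, L (T v) = L v)
    (ha : ∀ p : E →L[ℝ] ℝ, p a = L (0, p)) : a ∈ D := by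
  rw [← Subspace.forall_mem_dualAnnihilator_apply_eq_zero_iff]
  intro p hp
  have hp' : ∀ u ∈ D, p u = 0 := (Submodule.mem_dualAnnihilator p).1 hp
  obtain ⟨d, hd, hpd⟩ := hT.vertical_range (LinearMap.toContinuousLinearMap p)
  have h1 : b d d = 0 := by
    rw [← hpd, hT.vertical_apply _ d hd]
    exact hp' d hd
  have h2 : T (0, LinearMap.toContinuousLinearMap p) = 0 := by
    refine Prod.ext (hT.fst_apply _) ?_
    rw [hpd, hT.eq_zero_of_apply_self h1, map_zero, Prod.snd_zero]
  have h3 := ha (LinearMap.toContinuousLinearMap p)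
  rwa [← hL, h2, map_zero] at h3

end IsProjectionDerivative

theorem orthogonalProjectionAlong_mem {V : Type*} [AddCommGroup V] [Module ℝ V]
    {B : LinearMap.BilinForm ℝ V} {W : Submodule ℝ V} (h : IsCompl W (B.orthogonal W)) (v : V) :
    orthogonalProjectionAlong B W v ∈ W := by
  -- The projection has the default value `0` unless the two spaces are complementary; `h` selects
  -- the genuine branch.
  rw [orthogonalProjectionAlong, dif_pos h]
  exact Submodule.coe_mem _

theorem sub_orthogonalProjectionAlong_mem {V : Type*} [AddCommGroup V] [Module ℝ V]
    {B : LinearMap.BilinForm ℝ V} {W : Submodule ℝ V} (h : IsCompl W (B.orthogonal W)) (v : V) :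
    v - orthogonalProjectionAlong B W v ∈ B.orthogonal W := by
  rw [orthogonalProjectionAlong, dif_pos h, ← Submodule.projectionOnto_apply_eq_zero_iff h,
    map_sub, sub_eq_zero]
  exact (Submodule.projectionOnto_apply_left h _).symm

theorem orthogonalProjectionAlong_eq_of_sub_mem {V : Type*} [AddCommGroup V] [Module ℝ V]
    {B : LinearMap.BilinForm ℝ V} {W : Submodule ℝ V} (h : IsCompl W (B.orthogonal W)) {v w : V}
    (hvw : v - w ∈ B.orthogonal W) :
    orthogonalProjectionAlong B W v = orthogonalProjectionAlong B W w := by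
  rw [orthogonalProjectionAlong, dif_pos h, ← sub_eq_zero, ← map_sub, LinearMap.comp_apply,
    (Submodule.projectionOnto_apply_eq_zero_iff h).2 hvw, map_zero]

end LinearAlgebra

/-! ### The derivative of `γ` along `M` and the tangent space of `M`. -/

section ProjectionDerivative

variable {E : Type*} [NormedAddCommGroup E] [NormedSpace ℝ E] [FiniteDimensional ℝ E]
  {Q : Type*} [TopologicalSpace Q] [ChartedSpace E Q] [IsManifold 𝓘(ℝ, E) ∞ Q]
  {k : ℕ} (g : SmoothMetric E Q) (D : SmoothDistribution E Q k)

theorem hasMFDerivAt_extChartAt_self (x : CotangentBundle E Q) :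
    HasMFDerivAt (cotangentModel E) 𝓘(ℝ, E × (E →L[ℝ] ℝ)) (extChartAt (cotangentModel E) x) x
      (ContinuousLinearMap.id ℝ (E × (E →L[ℝ] ℝ))) := by
  have := (mdifferentiableAt_extChartAt (I := cotangentModel E)
    (mem_chart_source _ x)).hasMFDerivAt
  rwa [mfderiv_extChartAt_self] at this

theorem mdifferentiableAt_cotangent_proj (x : CotangentBundle E Q) :
    MDifferentiableAt (cotangentModel E) 𝓘(ℝ, E) (fun y : CotangentBundle E Q => y.proj) x :=
  (contMDiff_proj (n := ∞) _ x).mdifferentiableAt (by simp)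

/-- The chart of `Q` at the base point has identity derivative there, so `Tπ` coincides with `dq`.
-/
theorem projDifferential_apply (x : CotangentBundle E Q) (v : E × (E →L[ℝ] ℝ)) :
    projDifferential x v = v.1 := by
  have h1 := (mdifferentiableAt_extChartAt (I := 𝓘(ℝ, E))
    (mem_chart_source E x.proj)).hasMFDerivAt
  rw [mfderiv_extChartAt_self] at h1
  have h2 := (h1.comp x (mdifferentiableAt_cotangent_proj x).hasMFDerivAt).mfderiv
  have h3 : dqAt x v = projDifferential x v := DFunLike.congr_fun h2 v
  rw [← h3, (mfderiv_coords x).1]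
  rfl

/-- The inclusion of the fibre `T*_q Q` into `T*Q`. -/
def cotangentFiberInclusion (q : Q) (β : E →L[ℝ] ℝ) : CotangentBundle E Q :=
  ⟨q, β⟩

theorem extChartAt_cotangentFiberInclusion (q : Q) (α β : E →L[ℝ] ℝ) :
    extChartAt (cotangentModel E) (cotangentFiberInclusion q α) (cotangentFiberInclusion q β) =
      (extChartAt 𝓘(ℝ, E) q q, β) := by
  rw [extChartAt_cotangentBundle (cotangentFiberInclusion q α) (cotangentFiberInclusion q β)
    (mem_chart_source E q)]
  have h : pCoord (cotangentFiberInclusion q α) (cotangentFiberInclusion q β) = β := by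
    unfold pCoord
    change β.comp (mfderiv 𝓘(ℝ, E) 𝓘(ℝ, E) (extChartAt 𝓘(ℝ, E) q) q).inverse = β
    rw [mfderiv_extChartAt_self]
    ext w
    exact congrArg β (DFunLike.congr_fun ContinuousLinearMap.inverse_id w)
  rw [h]
  rfl

/-- In the chart at `(q, α)`, whose derivative there is the identity, the inclusion reads `β ↦
(φ(q), β)` with `φ` the chart of `Q` at `q`. -/
theorem hasMFDerivAt_cotangentFiberInclusion (q : Q) (α : E →L[ℝ] ℝ) :
    HasMFDerivAt 𝓘(ℝ, E →L[ℝ] ℝ) (cotangentModel E) (cotangentFiberInclusion q) α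
      (ContinuousLinearMap.inr ℝ E (E →L[ℝ] ℝ)) := by
  set e := extChartAt (cotangentModel E) (cotangentFiberInclusion q α) with he
  have h1 : cotangentFiberInclusion q = fun β => e.symm (extChartAt 𝓘(ℝ, E) q q, β) := by
    funext β
    rw [← extChartAt_cotangentFiberInclusion q α β, PartialEquiv.left_inv]
    exact mem_extChartAt_source_cotangent_iff.2 (mem_extChartAt_source q)
  have h2 : MDifferentiableAt 𝓘(ℝ, E →L[ℝ] ℝ) (cotangentModel E) (cotangentFiberInclusion q) α := by
    have h3 : ContMDiffAt 𝓘(ℝ, E × (E →L[ℝ] ℝ)) (cotangentModel E) ∞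
        e.symm (extChartAt 𝓘(ℝ, E) q q, α) := by
      rw [← extChartAt_cotangentFiberInclusion q α α]
      exact (contMDiffOn_extChartAt_symm _).contMDiffAt (extChartAt_target_mem_nhds _)
    have h4 : ContMDiffAt 𝓘(ℝ, E →L[ℝ] ℝ) 𝓘(ℝ, E × (E →L[ℝ] ℝ)) ∞
        (fun β : E →L[ℝ] ℝ => (extChartAt 𝓘(ℝ, E) q q, β)) α :=
      (contDiffAt_const.prodMk contDiffAt_id).contMDiffAt
    rw [h1]
    exact (h3.comp α h4).mdifferentiableAt (by simp)
  have h5 := (hasMFDerivAt_extChartAt_self (cotangentFiberInclusion q α)).comp α h2.hasMFDerivAt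
  have h6 : HasMFDerivAt 𝓘(ℝ, E →L[ℝ] ℝ) 𝓘(ℝ, E × (E →L[ℝ] ℝ))
      (fun β : E →L[ℝ] ℝ => (extChartAt 𝓘(ℝ, E) q q, β)) α
      (ContinuousLinearMap.inr ℝ E (E →L[ℝ] ℝ)) :=
    ((hasFDerivAt_const (extChartAt 𝓘(ℝ, E) q q) α).prodMk (hasFDerivAt_id α)).hasMFDerivAt
  have h7 := hasMFDerivAt_unique h5 (h6.congr_of_eventuallyEq
    (.of_forall fun β => extChartAt_cotangentFiberInclusion q α β))
  have h8 : mfderiv 𝓘(ℝ, E →L[ℝ] ℝ) (cotangentModel E) (cotangentFiberInclusion q) α =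
      ContinuousLinearMap.inr ℝ E (E →L[ℝ] ℝ) := (ContinuousLinearMap.id_comp _).symm.trans h7
  rw [← h8]
  exact h2.hasMFDerivAt

/-- The derivative of `γ` at a point of `M`, as an endomorphism of `T_x(T*Q) = E × E*`. -/
def edenDerivative (x : CotangentBundle E Q) : E × (E →L[ℝ] ℝ) →L[ℝ] E × (E →L[ℝ] ℝ) :=
  mfderiv (cotangentModel E) (cotangentModel E) (edenEndomorphism g D) x

theorem hasMFDerivAt_edenEndomorphism (x : CotangentBundle E Q) :
    HasMFDerivAt (cotangentModel E) (cotangentModel E) (edenEndomorphism g D) x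
      (edenDerivative g D x) :=
  ((contMDiff_edenEndomorphism g D x).mdifferentiableAt (by simp)).hasMFDerivAt

variable {g D}

/-- The chain rule for a composition with `γ` at a point of `M`. -/
theorem HasMFDerivAt.comp_edenEndomorphism {E' : Type*} [NormedAddCommGroup E'] [NormedSpace ℝ E']
    {H' : Type*} [TopologicalSpace H'] {J : ModelWithCorners ℝ E' H'}
    {Y : Type*} [TopologicalSpace Y] [ChartedSpace H' Y] {x : CotangentBundle E Q}
    (hx : x ∈ constraintSubmanifold g D) {F : CotangentBundle E Q → Y}
    {F' : E × (E →L[ℝ] ℝ) →L[ℝ] E'} (hF : HasMFDerivAt (cotangentModel E) J F x F') :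
    HasMFDerivAt (cotangentModel E) J (fun y => F (edenEndomorphism g D y)) x
      (F'.comp (edenDerivative g D x)) := by
  -- The chain rule asks for the derivative of `F` at `γ(x)`, which equals `x` only propositionally;
  -- substitution transports it.
  have h1 : ∀ z, z = x → HasMFDerivAt (cotangentModel E) J F z F' := by
    rintro _ rfl
    exact hF
  exact (h1 _ (edenEndomorphism_of_mem g D hx)).comp x (hasMFDerivAt_edenEndomorphism g D x)

/-- `M` is the fixed set of `γ`. For a linear form `ℓ` and the chart `e`, the function `ℓ ∘ e ∘ γ -
ℓ ∘ e` vanishes on `M` near `x` and has differential `ℓ(Tγ v - v)`. Conversely, if `F` vanishes on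
`M` near `x`, then `F ∘ γ` vanishes near `x`, so `dF(Tγ v) = 0`. -/
theorem mem_tangentSpaceOfSubset_iff {x : CotangentBundle E Q}
    (hx : x ∈ constraintSubmanifold g D) (v : E × (E →L[ℝ] ℝ)) :
    v ∈ tangentSpaceOfSubset (cotangentModel E) (constraintSubmanifold g D) x ↔
      edenDerivative g D x v = v := by
  have hΓ := (contMDiff_edenEndomorphism g D).continuous
  constructor
  · intro hv
    set e := extChartAt (cotangentModel E) x with he
    have hes : IsOpen e.source := isOpen_extChartAt_source x
    have hem : ContMDiffOn (cotangentModel E) 𝓘(ℝ, E × (E →L[ℝ] ℝ)) ∞ e e.source := by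
      rw [he, extChartAt_source]
      exact contMDiffOn_extChartAt
    rw [← sub_eq_zero]
    refine SeparatingDual.eq_zero_of_forall_dual_eq_zero (R := ℝ) fun ℓ => ?_
    have h1 : HasMFDerivAt (cotangentModel E) 𝓘(ℝ, ℝ) (fun z => ℓ (e z)) x ℓ :=
      ℓ.hasMFDerivAt.comp x (hasMFDerivAt_extChartAt_self x)
    have h2 := (h1.comp_edenEndomorphism hx).sub h1
    have h3 : ContMDiffOn (cotangentModel E) 𝓘(ℝ, ℝ) ∞ (fun z => ℓ (e z)) e.source :=
      ℓ.contMDiff.comp_contMDiffOn hem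
    have h4 := hv (e.source ∩ edenEndomorphism g D ⁻¹' e.source)
      ((fun y => ℓ (e (edenEndomorphism g D y))) - fun z => ℓ (e z)) (hes.inter (hes.preimage hΓ))
      ⟨mem_extChartAt_source x, by
        rw [Set.mem_preimage, edenEndomorphism_of_mem g D hx]; exact mem_extChartAt_source x⟩
      ((h3.comp (contMDiff_edenEndomorphism g D).contMDiffOn fun y hy => hy.2).sub
        (h3.mono Set.inter_subset_left))
      (fun y hy => by
        rw [Pi.sub_apply, edenEndomorphism_of_mem g D hy.2, sub_self])
    rw [h2.mfderiv] at h4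
    rw [map_sub]
    exact h4
  · intro hv U F hU hxU hF h0
    have h1 := ((hF.contMDiffAt (hU.mem_nhds hxU)).mdifferentiableAt (by simp)).hasMFDerivAt
    have h2 := HasMFDerivAt.comp_edenEndomorphism hx h1
    have h3 : (fun y => F (edenEndomorphism g D y)) =ᶠ[𝓝 x] fun _ => (0 : ℝ) := by
      have hxU' : edenEndomorphism g D x ∈ U := by rwa [edenEndomorphism_of_mem g D hx]
      filter_upwards [hΓ.continuousAt (hU.mem_nhds hxU')] with y hy
      exact h0 _ ⟨hy, edenEndomorphism_mem g D y⟩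
    have h4 := hasMFDerivAt_unique h2 ((hasMFDerivAt_const (0 : ℝ) x).congr_of_eventuallyEq h3)
    have h5 := DFunLike.congr_fun h4 v
    exact (congrArg (mfderiv (cotangentModel E) 𝓘(ℝ, ℝ) F x) hv).symm.trans h5

/-- On a fibre `γ` is the linear map `P`, which is its own derivative; `P α = α` keeps the base
point fixed. -/
theorem edenDerivative_vertical {q : Q} {α : E →L[ℝ] ℝ}
    (hα : cotangentFiberInclusion q α ∈ constraintSubmanifold g D) (p : E →L[ℝ] ℝ) :
    edenDerivative g D (cotangentFiberInclusion q α) (0, p) =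
      (0, (edenProjectionFiber g D q p : CotangentSpace E q)) := by
  let P : (E →L[ℝ] ℝ) →L[ℝ] (E →L[ℝ] ℝ) := LinearMap.toContinuousLinearMap
    (E := E →L[ℝ] ℝ) (F' := E →L[ℝ] ℝ)
    ((constraintFiber g D q).subtype ∘ₗ edenProjectionFiber g D q)
  have hP : P α = α := edenProjectionFiber_eq g D hα fun _ _ => rfl
  have h1 := (hasMFDerivAt_edenEndomorphism g D (cotangentFiberInclusion q α)).comp α
    (hasMFDerivAt_cotangentFiberInclusion q α)
  have h2 : HasMFDerivAt 𝓘(ℝ, E →L[ℝ] ℝ) (cotangentModel E) (cotangentFiberInclusion q) (P α)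
      (ContinuousLinearMap.inr ℝ E (E →L[ℝ] ℝ)) := by
    rw [hP]
    exact hasMFDerivAt_cotangentFiberInclusion q α
  have h3 := h2.comp α P.hasMFDerivAt
  have h4 : edenEndomorphism g D ∘ cotangentFiberInclusion q =
      cotangentFiberInclusion q ∘ P := rfl
  rw [h4] at h1
  exact DFunLike.congr_fun (hasMFDerivAt_unique h1 h3) p

/-- Differentiate `π ∘ γ = π` and `γ ∘ γ = γ` at a fixed point of `γ`; the vertical properties are
those of the fibre projection. -/
theorem isProjectionDerivative_edenDerivative {x : CotangentBundle E Q}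
    (hx : x ∈ constraintSubmanifold g D) :
    IsProjectionDerivative (E := E) (g.inner x.proj) (D.fiber x.proj) (edenDerivative g D x) := by
  have hvert : ∀ p : E →L[ℝ] ℝ, edenDerivative g D x (0, p) =
      (0, (edenProjectionFiber g D x.proj p : CotangentSpace E x.proj)) :=
    edenDerivative_vertical (E := E) (q := x.proj) (α := x.2) hx
  refine ⟨g.pos x.proj, fun v => ?_, fun v => ?_, fun p u hu => ?_, fun p => ?_, fun d hd => ?_⟩
  · have h1 := (mdifferentiableAt_cotangent_proj x).hasMFDerivAt
    have h2 := HasMFDerivAt.comp_edenEndomorphism hx h1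
    have h3 : projDifferential x (edenDerivative g D x v) = projDifferential x v :=
      DFunLike.congr_fun (hasMFDerivAt_unique h2 h1) v
    rwa [projDifferential_apply, projDifferential_apply] at h3
  · have h1 := HasMFDerivAt.comp_edenEndomorphism hx (hasMFDerivAt_edenEndomorphism g D x)
    have h2 : (fun y => edenEndomorphism g D (edenEndomorphism g D y)) = edenEndomorphism g D :=
      funext fun y => edenEndomorphism_of_mem g D (edenEndomorphism_mem g D y)
    rw [h2] at h1
    exact DFunLike.congr_fun (hasMFDerivAt_unique h1 (hasMFDerivAt_edenEndomorphism g D x)) v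
  · rw [hvert]
    exact edenProjectionFiber_apply_of_mem g D p hu
  · obtain ⟨d, hd, hd'⟩ := (edenProjectionFiber g D x.proj p).2
    rw [hvert]
    exact ⟨d, hd, hd'.symm⟩
  · rw [hvert]
    exact congrArg (Prod.mk 0) (edenProjectionFiber_eq g D ⟨d, hd, rfl⟩ fun _ _ => rfl)

end ProjectionDerivative

/-! ### The Eden bracket, the symplectic splitting and the equality of the brackets. -/

section NonholonomicBrackets

variable {E : Type*} [NormedAddCommGroup E] [NormedSpace ℝ E] [FiniteDimensional ℝ E]
  {Q : Type*} [TopologicalSpace Q] [ChartedSpace E Q] [IsManifold 𝓘(ℝ, E) ∞ Q]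

theorem functionDifferential_add {F G : CotangentBundle E Q → ℝ}
    (hF : ContMDiff (cotangentModel E) 𝓘(ℝ, ℝ) ∞ F)
    (hG : ContMDiff (cotangentModel E) 𝓘(ℝ, ℝ) ∞ G) (x : CotangentBundle E Q) :
    functionDifferential (fun y => F y + G y) x =
      functionDifferential F x + functionDifferential G x :=
  (((hF x).mdifferentiableAt (by simp)).hasMFDerivAt.add
    ((hG x).mdifferentiableAt (by simp)).hasMFDerivAt).mfderiv

theorem functionDifferential_const_mul {F : CotangentBundle E Q → ℝ}
    (hF : ContMDiff (cotangentModel E) 𝓘(ℝ, ℝ) ∞ F) (c : ℝ) (x : CotangentBundle E Q) :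
    functionDifferential (fun y => c * F y) x = c • functionDifferential F x :=
  (((hF x).mdifferentiableAt (by simp)).hasMFDerivAt.const_smul c).mfderiv

theorem functionDifferential_mul {F G : CotangentBundle E Q → ℝ}
    (hF : ContMDiff (cotangentModel E) 𝓘(ℝ, ℝ) ∞ F)
    (hG : ContMDiff (cotangentModel E) 𝓘(ℝ, ℝ) ∞ G) (x : CotangentBundle E Q) :
    functionDifferential (fun y => F y * G y) x =
      F x • functionDifferential G x + G x • functionDifferential F x :=
  (((hF x).mdifferentiableAt (by simp)).hasMFDerivAt.mul
    ((hG x).mdifferentiableAt (by simp)).hasMFDerivAt).mfderiv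

theorem canonicalSymplecticForm_swap (x : CotangentBundle E Q)
    (u v : TangentSpace (cotangentModel E) x) :
    canonicalSymplecticForm x v u = -canonicalSymplecticForm x u v := by
  have h1 := canonicalSymplecticForm_apply x v u
  have h2 := canonicalSymplecticForm_apply x u v
  rw [h1, h2, neg_sub]

theorem canonicalBracket_swap (F G : CotangentBundle E Q → ℝ) (x : CotangentBundle E Q) :
    canonicalBracket G F x = -canonicalBracket F G x :=
  canonicalSymplecticForm_swap x _ _

/-- In this form the first argument enters only through its differential, so linearity and the
Leibniz rule are inherited from `d`. -/
theorem canonicalBracket_eq_functionDifferential (F G : CotangentBundle E Q → ℝ)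
    (x : CotangentBundle E Q) :
    canonicalBracket F G x = functionDifferential F x (hamiltonianVectorField G x) :=
  canonicalSymplecticForm_hamiltonianVectorField F x _

variable {k : ℕ} (g : SmoothMetric E Q) (D : SmoothDistribution E Q k)

/-- The bracket `{f ∘ γ, g ∘ γ}_can ∘ i_M` as a smooth function on `M`. -/
def edenBracketFunction (f₁ f₂ : smoothFunctions (cotangentModel E) (constraintSubmanifold g D)) :
    smoothFunctions (cotangentModel E) (constraintSubmanifold g D) :=
  ⟨fun x => canonicalBracket (fun y => f₁.1 (edenProjection g D y))
      (fun y => f₂.1 (edenProjection g D y)) x.1,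
    fun _ => ⟨Set.univ, isOpen_univ, Set.mem_univ _, _,
      (contMDiff_canonicalBracket (isSmoothExtension_comp_edenProjection g D f₁).1
        (isSmoothExtension_comp_edenProjection g D f₂).1).contMDiffOn, fun _ _ => rfl⟩⟩

theorem edenBracketFunction_swap
    (f₁ f₂ : smoothFunctions (cotangentModel E) (constraintSubmanifold g D)) :
    edenBracketFunction g D f₂ f₁ = -edenBracketFunction g D f₁ f₂ :=
  Subtype.ext (funext fun _ => canonicalBracket_swap _ _ _)

theorem edenBracketFunction_add_left
    (f₁ f₂ f₃ : smoothFunctions (cotangentModel E) (constraintSubmanifold g D)) :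
    edenBracketFunction g D (f₁ + f₂) f₃ =
      edenBracketFunction g D f₁ f₃ + edenBracketFunction g D f₂ f₃ := by
  refine Subtype.ext (funext fun x => ?_)
  have h := functionDifferential_add (isSmoothExtension_comp_edenProjection g D f₁).1
    (isSmoothExtension_comp_edenProjection g D f₂).1 x.1
  change canonicalBracket (fun y => f₁.1 (edenProjection g D y) + f₂.1 (edenProjection g D y)) _ x.1
    = canonicalBracket _ _ x.1 + canonicalBracket _ _ x.1
  simp only [canonicalBracket_eq_functionDifferential]
  rw [h]
  rfl

theorem edenBracketFunction_smul_left (c : ℝ)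
    (f₁ f₂ : smoothFunctions (cotangentModel E) (constraintSubmanifold g D)) :
    edenBracketFunction g D (c • f₁) f₂ = c • edenBracketFunction g D f₁ f₂ := by
  refine Subtype.ext (funext fun x => ?_)
  have h := functionDifferential_const_mul (isSmoothExtension_comp_edenProjection g D f₁).1 c x.1
  change canonicalBracket (fun y => c * f₁.1 (edenProjection g D y)) _ x.1
    = c * canonicalBracket _ _ x.1
  simp only [canonicalBracket_eq_functionDifferential]
  rw [h]
  rfl

theorem edenBracketFunction_mul_left
    (f₁ f₂ f₃ : smoothFunctions (cotangentModel E) (constraintSubmanifold g D)) :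
    edenBracketFunction g D (f₁ * f₂) f₃ =
      f₁ * edenBracketFunction g D f₂ f₃ + f₂ * edenBracketFunction g D f₁ f₃ := by
  refine Subtype.ext (funext fun x => ?_)
  have h := functionDifferential_mul (isSmoothExtension_comp_edenProjection g D f₁).1
    (isSmoothExtension_comp_edenProjection g D f₂).1 x.1
  -- At points of `M` the coefficients `f(γ(x))` of the product rule become `f(x)`.
  rw [edenProjection_of_mem] at h
  change canonicalBracket (fun y => f₁.1 (edenProjection g D y) * f₂.1 (edenProjection g D y)) _ x.1
    = f₁.1 x * canonicalBracket _ _ x.1 + f₂.1 x * canonicalBracket _ _ x.1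
  simp only [canonicalBracket_eq_functionDifferential]
  rw [h]
  rfl

/-- The Eden bracket `{f, g}_E = {f ∘ γ, g ∘ γ}_can ∘ i_M` on `M`. -/
def edenBracket : AlmostPoissonBracket (cotangentModel E) (constraintSubmanifold g D) where
  bracket := LinearMap.mk₂ ℝ (edenBracketFunction g D) (edenBracketFunction_add_left g D)
    (edenBracketFunction_smul_left g D)
    (fun f₁ f₂ f₃ => by
      rw [edenBracketFunction_swap, edenBracketFunction_add_left, neg_add,
        ← edenBracketFunction_swap, ← edenBracketFunction_swap])
    (fun c f₁ f₂ => by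
      rw [edenBracketFunction_swap, edenBracketFunction_smul_left, ← smul_neg,
        ← edenBracketFunction_swap])
  skew := edenBracketFunction_swap g D
  leibniz := edenBracketFunction_mul_left g D

theorem isEdenBracket_edenBracket : IsEdenBracket g D (edenBracket g D) :=
  fun _ _ _ => rfl

variable {g D}

theorem mem_constrainedTangentSpace_iff {x : CotangentBundle E Q}
    (hx : x ∈ constraintSubmanifold g D) (v : E × (E →L[ℝ] ℝ)) :
    v ∈ constrainedTangentSpace g D x ↔ edenDerivative g D x v = v ∧ v.1 ∈ D.fiber x.proj := by
  rw [← mem_tangentSpaceOfSubset_iff hx, ← projDifferential_apply x v]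
  exact Iff.rfl

theorem canonicalSymplecticForm_eq_zero_of_vertical {x : CotangentBundle E Q}
    {u v : TangentSpace (cotangentModel E) x} (hu : projDifferential x u = 0)
    (hv : projDifferential x v = 0) : canonicalSymplecticForm x u v = 0 := by
  have key : ∀ a b : E × (E →L[ℝ] ℝ), a.1 = 0 → b.1 = 0 → b.2 a.1 - a.2 b.1 = 0 := by
    intro a b ha hb
    rw [ha, hb, map_zero, map_zero, sub_zero]
  exact (canonicalSymplecticForm_apply x u v).trans
    (key u v ((projDifferential_apply x u).symm.trans hu)
      ((projDifferential_apply x v).symm.trans hv))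

/-- A vector which is symplectically orthogonal to `(T^D M)_x` and projects to `D` is vertical. -/
theorem projDifferential_eq_zero_of_mem_orthogonal {x : CotangentBundle E Q}
    (hx : x ∈ constraintSubmanifold g D) {v : TangentSpace (cotangentModel E) x}
    (hv : projDifferential x v ∈ D.fiber x.proj)
    (h : v ∈ (canonicalSymplecticForm x).orthogonal (constrainedTangentSpace g D x)) :
    projDifferential x v = 0 := by
  have hp := projDifferential_apply x v
  rw [hp] at hv ⊢
  refine (isProjectionDerivative_edenDerivative hx).fst_eq_zero_of_orthogonal
    (mem_constrainedTangentSpace_iff hx) hv fun w hw => ?_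
  exact (canonicalSymplecticForm_apply x w v).symm.trans (h w hw)

/-- For a reflexive form in finite dimension, a subspace and its orthogonal are complementary as
soon as they meet in zero. -/
theorem isCompl_constrainedTangentSpace {x : CotangentBundle E Q}
    (hx : x ∈ constraintSubmanifold g D) :
    IsCompl (constrainedTangentSpace g D x)
      ((canonicalSymplecticForm x).orthogonal (constrainedTangentSpace g D x)) := by
  have hrefl : (canonicalSymplecticForm x).IsRefl := fun u v h => by
    rw [canonicalSymplecticForm_swap, h, neg_zero]
  rw [LinearMap.BilinForm.isCompl_orthogonal_iff_disjoint hrefl, Submodule.disjoint_def]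
  intro v hv hv'
  refine (isProjectionDerivative_edenDerivative hx).eq_zero_of_mem_of_orthogonal
    (mem_constrainedTangentSpace_iff hx) hv fun w hw => ?_
  exact (canonicalSymplecticForm_apply x w v).symm.trans (hv' w hw)

/-- The symplectic form is preserved by `𝒫` on the vectors that project to `D`. -/
theorem canonicalSymplecticForm_symplecticProjection {x : CotangentBundle E Q}
    (hx : x ∈ constraintSubmanifold g D) {u v : TangentSpace (cotangentModel E) x}
    (hu : projDifferential x u ∈ D.fiber x.proj) (hv : projDifferential x v ∈ D.fiber x.proj) :
    canonicalSymplecticForm x (symplecticProjection g D x u) (symplecticProjection g D x v) =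
      canonicalSymplecticForm x u v := by
  have hc := isCompl_constrainedTangentSpace hx
  have hmem := orthogonalProjectionAlong_mem hc
  have hsub := sub_orthogonalProjectionAlong_mem hc
  -- Both `w` and `𝒫w` project to `D`, so `w - 𝒫w` is an element of `W^⊥` projecting to `D`, hence
  -- vertical.
  have hvert : ∀ w, projDifferential x w ∈ D.fiber x.proj →
      projDifferential x (w - symplecticProjection g D x w) = 0 := fun w hw =>
    projDifferential_eq_zero_of_mem_orthogonal hx
      (by rw [map_sub]; exact Submodule.sub_mem _ hw (hmem w).2) (hsub w)
  -- In the expansion of `ω(u, v)` along `u = 𝒫u + (u - 𝒫u)` and `v = 𝒫v + (v - 𝒫v)`, the mixed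
  -- terms vanish by orthogonality and the last term because both factors are vertical.
  have h1 : canonicalSymplecticForm x (symplecticProjection g D x u)
      (v - symplecticProjection g D x v) = 0 := hsub v _ (hmem u)
  have h2 : canonicalSymplecticForm x (symplecticProjection g D x v)
      (u - symplecticProjection g D x u) = 0 := hsub u _ (hmem v)
  have h3 : canonicalSymplecticForm x (u - symplecticProjection g D x u)
      (v - symplecticProjection g D x v) = 0 :=
    canonicalSymplecticForm_eq_zero_of_vertical (hvert u hu) (hvert v hv)
  have h4 := canonicalSymplecticForm_swap x (symplecticProjection g D x u)
    (symplecticProjection g D x v)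
  have h5 := canonicalSymplecticForm_swap x u (symplecticProjection g D x v)
  simp only [map_sub, LinearMap.sub_apply] at h1 h2 h3
  linarith

/-- The difference of two extensions vanishes on `M`, so vectors tangent to `M` annihilate its
differential. -/
theorem functionDifferential_eq_of_isSmoothExtension
    {f : constraintSubmanifold g D → ℝ} {F F' : CotangentBundle E Q → ℝ}
    (hF : IsSmoothExtension (cotangentModel E) f F)
    (hF' : IsSmoothExtension (cotangentModel E) f F') {x : CotangentBundle E Q}
    {v : TangentSpace (cotangentModel E) x}
    (hv : v ∈ tangentSpaceOfSubset (cotangentModel E) (constraintSubmanifold g D) x) :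
    functionDifferential F x v = functionDifferential F' x v := by
  have h1 := hv Set.univ (F - F') isOpen_univ (Set.mem_univ x) (hF.1.sub hF'.1).contMDiffOn
    fun y hy => by rw [Pi.sub_apply, hF.2 ⟨y, hy.2⟩, hF'.2 ⟨y, hy.2⟩, sub_self]
  have h2 := (((hF.1 x).mdifferentiableAt (by simp)).hasMFDerivAt.sub
    ((hF'.1 x).mdifferentiableAt (by simp)).hasMFDerivAt).mfderiv
  rw [h2] at h1
  exact sub_eq_zero.1 h1

/-- `𝒫 X_F` at a point of `M` depends only on the restriction of `F` to `M`. -/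
theorem symplecticProjection_hamiltonianVectorField_eq
    {f : constraintSubmanifold g D → ℝ} {F F' : CotangentBundle E Q → ℝ}
    (hF : IsSmoothExtension (cotangentModel E) f F)
    (hF' : IsSmoothExtension (cotangentModel E) f F') {x : CotangentBundle E Q}
    (hx : x ∈ constraintSubmanifold g D) :
    symplecticProjection g D x (hamiltonianVectorField F x) =
      symplecticProjection g D x (hamiltonianVectorField F' x) := by
  refine orthogonalProjectionAlong_eq_of_sub_mem (isCompl_constrainedTangentSpace hx) ?_
  intro w hw
  change canonicalSymplecticForm x w _ = 0
  rw [canonicalSymplecticForm_swap, map_sub, LinearMap.sub_apply,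
    canonicalSymplecticForm_hamiltonianVectorField, canonicalSymplecticForm_hamiltonianVectorField,
    functionDifferential_eq_of_isSmoothExtension hF hF' hw.1, sub_self, neg_zero]

/-- At the points of `M`, the Hamiltonian vector field of `f ∘ γ` projects to `D`. -/
theorem projDifferential_hamiltonianVectorField_mem
    (f : smoothFunctions (cotangentModel E) (constraintSubmanifold g D)) {x : CotangentBundle E Q}
    (hx : x ∈ constraintSubmanifold g D) :
    projDifferential x (hamiltonianVectorField (fun y => f.1 (edenProjection g D y)) x) ∈
      D.fiber x.proj := by
  set F : CotangentBundle E Q → ℝ := fun y => f.1 (edenProjection g D y)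
  have hF := (isSmoothExtension_comp_edenProjection g D f).1
  have h1 : HasMFDerivAt (cotangentModel E) 𝓘(ℝ, ℝ) F x (functionDifferential F x) :=
    ((hF x).mdifferentiableAt (by simp)).hasMFDerivAt
  have h2 := HasMFDerivAt.comp_edenEndomorphism hx h1
  -- Idempotence of `γ` gives `F ∘ γ = F`, so `dF` is invariant under `Tγ` at `x`.
  have h3 : (fun y => F (edenEndomorphism g D y)) = F :=
    funext fun y => congrArg f.1 (edenProjection_of_mem g D (edenProjection g D y))
  rw [h3] at h2
  have hp := projDifferential_apply x (hamiltonianVectorField F x)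
  rw [hp]
  refine (isProjectionDerivative_edenDerivative hx).mem_of_invariant
    (L := functionDifferential F x) (fun v => DFunLike.congr_fun (hasMFDerivAt_unique h2 h1) v)
    fun p => ?_
  -- Evaluating `i_X ω = dF` on the vertical vector `(0, p)` isolates the base component of `X_F`.
  have h4 := canonicalSymplecticForm_hamiltonianVectorField F x ((0, p) : E × (E →L[ℝ] ℝ))
  have h5 := canonicalSymplecticForm_apply x (hamiltonianVectorField F x)
    ((0, p) : E × (E →L[ℝ] ℝ))
  refine Eq.trans ?_ (h5.symm.trans h4)
  rw [map_zero, sub_zero]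

/-- Any extensions may be replaced by `f ∘ γ` without changing `𝒫 X_F`; their Hamiltonian fields
project to `D` along `M`, where `𝒫` can be dropped from the form. -/
theorem isNonholonomicBracket_edenBracket : IsNonholonomicBracket g D (edenBracket g D) := by
  refine ⟨fun f => ⟨_, isSmoothExtension_comp_edenProjection g D f⟩,
    fun f₁ f₂ F₁ F₂ hF₁ hF₂ x => ?_⟩
  rw [symplecticProjection_hamiltonianVectorField_eq hF₁
      (isSmoothExtension_comp_edenProjection g D f₁) x.2,
    symplecticProjection_hamiltonianVectorField_eq hF₂
      (isSmoothExtension_comp_edenProjection g D f₂) x.2,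
    canonicalSymplecticForm_symplecticProjection x.2
      (projDifferential_hamiltonianVectorField_mem f₁ x.2)
      (projDifferential_hamiltonianVectorField_mem f₂ x.2)]
  rfl

end NonholonomicBrackets

section Subsets

variable {E₁ : Type*} [NormedAddCommGroup E₁] [NormedSpace ℝ E₁]
  {H₁ : Type*} [TopologicalSpace H₁] {I : ModelWithCorners ℝ E₁ H₁}
  {X : Type*} [TopologicalSpace X] [ChartedSpace H₁ X]

theorem isSmoothOnSubset_coe (S : Set X) : IsSmoothOnSubset I I S (fun x => (x : X)) :=
  fun _ => ⟨Set.univ, isOpen_univ, Set.mem_univ _, id, contMDiffOn_id, fun _ _ => rfl⟩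

theorem isAlmostPoissonIso_refl {S : Set X} (B : AlmostPoissonBracket I S) :
    IsAlmostPoissonIso B B (Equiv.refl S) where
  smooth := isSmoothOnSubset_coe S
  smooth_symm := isSmoothOnSubset_coe S
  map_bracket _ _ := rfl

end Subsets

end

theorem theorem2 {E : Type*} [NormedAddCommGroup E] [NormedSpace ℝ E] [FiniteDimensional ℝ E]
    {Q : Type*} [TopologicalSpace Q] [ChartedSpace E Q] [IsManifold 𝓘(ℝ, E) ∞ Q]
    {k : ℕ} (g : SmoothMetric E Q) (D : SmoothDistribution E Q k) :
    (∀ x ∈ constraintSubmanifold g D,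
      IsCompl (constrainedTangentSpace g D x)
        ((canonicalSymplecticForm x).orthogonal (constrainedTangentSpace g D x))) ∧
    ∃ Bnh BE : AlmostPoissonBracket (cotangentModel E) (constraintSubmanifold g D),
      IsNonholonomicBracket g D Bnh ∧ IsEdenBracket g D BE ∧
        IsAlmostPoissonIso Bnh BE (Equiv.refl (constraintSubmanifold g D)) := by
  -- One bracket witnesses both descriptions. Each description fixes all values of its bracket, the
  -- nonholonomic one because extensions exist, so nothing is lost by this choice.
  exact ⟨fun x hx => isCompl_constrainedTangentSpace hx, edenBracket g D, edenBracket g D,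
    isNonholonomicBracket_edenBracket, isEdenBracket_edenBracket g D, isAlmostPoissonIso_refl _⟩
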